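/- **Setting.** Let $T>0$, $d\in\mathbb N$, $S_d=\{m\in\mathbb R^d: m_i\ge 0,\ \sum_i m_i=1\}$ with the Euclidean norm, and for $N\ge1$ let $S_d^N=S_d\cap\frac1N\mathbb N^d$. Let $A$ be a nonempty compact metric space, let $Q_{i,j}(t,a,m)\ge 0$, $f^i(t,a,m)$ and $g^i(m)$ ($1\le i,j\le d$) be real functions of $t\in[0,T]$, $a\in A$, $m\in S_d$, and put $F(t,a^1,\dots,a^d,m)=\sum_i m_i f^i(t,a^i,m)$, $G(m)=\sum_i m_i g^i(m)$. Assume (A): $Q_{i,j}$ is continuous on $[0,T]\times A\times S_d$ and $F$ is continuous on $[0,T]\times A^d\times S_d$; both are Lipschitz in $(t,m)$ uniformly in the actions, i.e. $|Q_{i,j}(t,a,m)-Q_{i,j}(s,a,p)|\le C(|t-s|+|m-p|)$ and $|F(t,a,m)-F(s,a,p)|\le C(|t-s|+|m-p|)$; and $|G(m)-G(p)|\le C|m-p|$. Let $H^i(t,m,z)=\max_{a\in A}\{-\sum_j Q_{i,j}(t,a,m)z_j-f^i(t,a,m)\}$ (only needed where $m_i>0$; terms with $m_i=0$ below are zero)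 and, for $v:S_d^N\to\mathbb R$, $D^{N,i}_jv(m)=N[v(m+\frac1N(\delta_j-\delta_i))-v(m)]$. The HJB system on $[0,T]\times S_d^N$ is $$-\frac{d}{dt}V^N(t,m)+\sum_i m_iH^i\big(t,m,D^{N,i}V^N(t,m)\big)=0,\qquad V^N(T,m)=\sum_i m_ig^i(m).\tag{HJB}$$ *Empirical-measure problem.* A feedback is a map $\alpha=\alpha(t,i,m)\in A$ for $t\in[0,T]$, $1\le i\le d$, $m\in S_d^N$, measurable in $t$. Under $\alpha$, $\mu$ is the time-inhomogeneous Markov chain on $S_d^N$ with generator $L^\alpha_t\varphi(m)=N\sum_{i,j}m_iQ_{i,j}(t,\alpha(t,i,m),m)[\varphi(m+\frac1N(\delta_j-\delta_i))-\varphi(m)]$. The cost on $[s,T]$ is $$J^N(s,\alpha)=\mathbb E\Big[\int_s^T\sum_i\mu_{i,t}f^i(t,\alpha(t,i,\mu_t),\mu_t)\,dt+\sum_i\mu_{i,T}g^i(\mu_T)\Big].$$ *Centralized $N$-agent problem.* A feedback is $\beta=(\beta_1,\dots,\beta_N)$ with $\beta_k(t,\boldsymbol x)\in A$ for $\boldsymbol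 x\in\{1,\dots,d\}^N$, measurable in $t$. With $\mu^N_{\boldsymbol x}=\frac1N\sum_k\delta_{x_k}$, and with $[\boldsymbol x^{-k},j]$ denoting $\boldsymbol x$ with its $k$-th entry replaced by $j$, $\boldsymbol X$ is the Markov chain on $\{1,\dots,d\}^N$ with generator $L^\beta_t\varphi(\boldsymbol x)=\sum_k\sum_{j\ne x_k}Q_{x_k,j}(t,\beta_k(t,\boldsymbol x),\mu^N_{\boldsymbol x})[\varphi([\boldsymbol x^{-k},j])-\varphi(\boldsymbol x)]$. The cost on $[s,T]$ is $$J^N(s,\beta)=\mathbb E\Big[\int_s^T\frac1N\sum_kf^{X^k_t}(t,\beta_k(t,\boldsymbol X_t),\mu^N_{\boldsymbol X_t})\,dt+\frac1N\sum_kg^{X^k_T}(\mu^N_{\boldsymbol X_T})\Big].$$ In both problems the chain is described by its transition function $p(s,t,x,y)$, $0\le s\le t\le T$: it is stochastic, the identity at $s=t$, continuous in $t$, satisfies the Chapman–Kolmogorov equations and Kolmogorov's forward equation $\sum_yp(s,t,x,y)\varphi(y)=\varphi(x)+\int_s^t\sum_zp(s,r,x,z)L_r\varphi(z)\,dr$ for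 all $\varphi$; expected costs are computed from the resulting laws. **Proposition.** Under (A) there is a constant $C$, independent of $N$, such that for every $N\ge1$: 1. (HJB) has a solution $V^N$, which is $\mathcal C^1$ in time on $[0,T]$ and is the unique solution. 2. For every feedback $\alpha$, and for every feedback $\beta$, the transition function of the controlled chain exists and is unique. For all $(t,m)\in[0,T]\times S_d^N$, $V^N(t,m)$ is the infimum over feedbacks $\alpha$ of the cost on $[t,T]$ in the empirical-measure problem with $\mu_t=m$; and there is one feedback that attains it for all $(t,m)$. 3. $|V^N(t,m)-V^N(s,p)|\le C(|t-s|+|m-p|)$ for all $t,s\in[0,T]$, $m,p\in S_d^N$. 4. The value function $v^N(t,\boldsymbol x)$ of the centralized $N$-agent problem (the infimum over feedbacks $\beta$ of the cost on $[t,T]$ with $\boldsymbol X_t=\boldsymbol x$) is $v^N(t,\boldsymbol x)=V^N(t,\mu^N_{\boldsymbol x})$ for all $t\in[0,T]$ and $\boldsymbol x\in\{1,\dots,d\}^N$. 5. For every $m_0\in S_d$, if the initial states $X^1_0,\dots,X^N_0$ are i.i.d. with law $m_0$, then the following infima of costs on $[0,T]$ are finite and equal: over all feedbacks $\beta$ in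 the $N$-agent problem; over the mean field feedbacks $\beta_k(t,\boldsymbol x)=\alpha(t,x_k,\mu^N_{\boldsymbol x})$ in the $N$-agent problem; and over all feedbacks $\alpha$ in the empirical-measure problem started from $\mu_0=\mu^N_{\boldsymbol X_0}$. -/

import Mathlib

open Set MeasureTheory

noncomputable section

/-- The Euclidean space `ℝ^d` in which the simplex lives. -/
abbrev StateVec (d : ℕ) : Type := EuclideanSpace ℝ (Fin d)

/-- The simplex `S_d` of probability vectors on `d` states. -/
def simplex (d : ℕ) : Set (StateVec d) :=
  {m | (∀ i, 0 ≤ m i) ∧ ∑ i, m i = 1}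

/-- The discretized simplex `S_d^N = S_d ∩ (1/N) ℕ^d`. -/
def gridSimplex (d N : ℕ) : Set (StateVec d) :=
  {m | m ∈ simplex d ∧ ∃ k : Fin d → ℕ, ∀ i, m i = (k i : ℝ) / (N : ℝ)}

theorem gridSimplex_finite (d N : ℕ) : (gridSimplex d N).Finite := by
  have hfin : (Set.range (fun k : Fin d → Fin (N + 1) =>
      (WithLp.toLp 2 (fun i => ((k i : ℕ) : ℝ) / (N : ℝ)) : StateVec d))).Finite :=
    Set.finite_range _
  refine hfin.subset ?_
  rintro m ⟨⟨h0, h1⟩, k, hk⟩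
  rcases Nat.eq_zero_or_pos N with hN | hN
  · subst hN
    simp [hk] at h1
  · have hle : ∀ i, k i < N + 1 := by
      intro i
      have hi : m i ≤ 1 := by
        rw [← h1]
        exact Finset.single_le_sum (f := fun j => m j) (fun j _ => h0 j) (Finset.mem_univ i)
      rw [hk i, div_le_one (Nat.cast_pos.2 hN)] at hi
      have : k i ≤ N := Nat.cast_le.1 hi
      omega
    refine ⟨fun i => ⟨k i, hle i⟩, ?_⟩
    ext i
    simp [hk i]

instance gridSimplexFintype (d N : ℕ) : Fintype (gridSimplex d N) :=
  (gridSimplex_finite d N).fintype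

/-- The vector `m + (δ_j - δ_i) / N`: one of the `N` agents moves from state `i` to state `j`. -/
def shift {d : ℕ} (N : ℕ) (m : StateVec d) (i j : Fin d) : StateVec d :=
  m + (1 / (N : ℝ)) • (EuclideanSpace.single j (1 : ℝ) - EuclideanSpace.single i (1 : ℝ))

/-- The empirical measure `μ^N_x` of a configuration `x` of `N` agents. -/
def empirical {d N : ℕ} (x : Fin N → Fin d) : StateVec d :=
  WithLp.toLp 2 (fun i => (1 / (N : ℝ)) * ∑ k, if x k = i then (1 : ℝ) else 0)

/-- Discretized derivative: the vector `D^{N,i} v (m)`, with `j`-th entry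
`N (v (m + (δ_j - δ_i) / N) - v m)`. -/
def discreteDeriv {d : ℕ} (N : ℕ) (i : Fin d) (v : StateVec d → ℝ) (m : StateVec d)
    (j : Fin d) : ℝ :=
  (N : ℝ) * (v (shift N m i j) - v m)

/-- The data of the problem: horizon `T`, transition rates `Q i j t a m`, running costs
`f i t a m` and terminal costs `g i m`. Only times in `[0, T]` and `m ∈ S_d` matter. -/
structure ControlData (d : ℕ) (A : Type*) where
  T : ℝ
  Q : Fin d → Fin d → ℝ → A → StateVec d → ℝ
  f : Fin d → ℝ → A → StateVec d → ℝ
  g : Fin d → StateVec d → ℝ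

namespace ControlData

/-- `F(t, a¹, …, a^d, m) = ∑ i, m_i f^i(t, a^i, m)`. -/
def F {d : ℕ} {A : Type*} (D : ControlData d A) (t : ℝ) (a : Fin d → A) (m : StateVec d) : ℝ :=
  ∑ i, m i * D.f i t (a i) m

/-- `G(m) = ∑ i, m_i g^i(m)`. -/
def G {d : ℕ} {A : Type*} (D : ControlData d A) (m : StateVec d) : ℝ :=
  ∑ i, m i * D.g i m

/-- The standing assumption on the coefficients: rates are nonnegative, continuous, and Lipschitz
in `(t, m)` uniformly in the action; `F` is continuous, and Lipschitz in `(t, m)` uniformly in the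
actions; `G` is Lipschitz. (Compactness of the action space is expressed by a type class.) -/
structure AssumptionA {d : ℕ} {A : Type*} [TopologicalSpace A] (D : ControlData d A) : Prop where
  Q_nonneg : ∀ i j, ∀ t ∈ Icc 0 D.T, ∀ a, ∀ m ∈ simplex d, 0 ≤ D.Q i j t a m
  Q_continuous : ∀ i j, ContinuousOn (fun z : ℝ × A × StateVec d => D.Q i j z.1 z.2.1 z.2.2)
    (Icc 0 D.T ×ˢ univ ×ˢ simplex d)
  Q_lipschitz : ∃ C : ℝ, ∀ i j, ∀ t ∈ Icc 0 D.T, ∀ s ∈ Icc 0 D.T, ∀ a,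
    ∀ m ∈ simplex d, ∀ p ∈ simplex d,
      |D.Q i j t a m - D.Q i j s a p| ≤ C * (|t - s| + ‖m - p‖)
  F_continuous : ContinuousOn (fun z : ℝ × (Fin d → A) × StateVec d => D.F z.1 z.2.1 z.2.2)
    (Icc 0 D.T ×ˢ univ ×ˢ simplex d)
  F_lipschitz : ∃ C : ℝ, ∀ t ∈ Icc 0 D.T, ∀ s ∈ Icc 0 D.T, ∀ a : Fin d → A,
    ∀ m ∈ simplex d, ∀ p ∈ simplex d,
      |D.F t a m - D.F s a p| ≤ C * (|t - s| + ‖m - p‖)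
  G_lipschitz : ∃ C : ℝ, ∀ m ∈ simplex d, ∀ p ∈ simplex d, |D.G m - D.G p| ≤ C * ‖m - p‖

/-- The Hamiltonian `H^i(t, m, z) = max_a (- ⟨Q_{i,•}(t, a, m), z⟩ - f^i(t, a, m))`. -/
def hamiltonian {d : ℕ} {A : Type*} (D : ControlData d A) (i : Fin d) (t : ℝ) (m : StateVec d)
    (z : Fin d → ℝ) : ℝ :=
  ⨆ a : A, (-(∑ j, D.Q i j t a m * z j) - D.f i t a m)

/-- `V` solves on `[0, T] × S_d^N` the Hamilton–Jacobi–Bellman system of ODEs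
`- d/dt V + ∑ i, m_i H^i(t, m, D^{N,i} V(t, m)) = 0`, `V(T, m) = ∑ i, m_i g^i(m)`
(one-sided derivatives at the end points). Values of `V` off `S_d^N` are irrelevant: the point
`m + (δ_j - δ_i) / N` can leave `S_d^N` only if `m_i = 0`. -/
structure IsHJBSolution {d : ℕ} {A : Type*} (D : ControlData d A) (N : ℕ)
    (V : ℝ → StateVec d → ℝ) : Prop where
  ode : ∀ t ∈ Icc 0 D.T, ∀ m ∈ gridSimplex d N,
    HasDerivWithinAt (fun s => V s m)
      (∑ i, m i * D.hamiltonian i t m (discreteDeriv N i (V t) m)) (Icc 0 D.T) t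
  terminal : ∀ m ∈ gridSimplex d N, V D.T m = ∑ i, m i * D.g i m

end ControlData

open Classical in
/-- The function `p s t x y = P(X_t = y | X_s = x)`, `0 ≤ s ≤ t ≤ T`, is the transition function of
the time-inhomogeneous Markov chain on the finite set `S` with generator `L_t`: it is stochastic,
satisfies the Chapman–Kolmogorov equations, is continuous in `t`, and satisfies Kolmogorov's
forward equation `E[φ(X_t) | X_s = x] = φ(x) + ∫_s^t E[L_r φ(X_r) | X_s = x] dr` for all `φ`
(in integrated form, since the generator depends only measurably on time). -/
structure IsTransitionFunction {S : Type*} [Fintype S] (T : ℝ)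
    (L : ℝ → (S → ℝ) → S → ℝ) (p : ℝ → ℝ → S → S → ℝ) : Prop where
  nonneg : ∀ s t, 0 ≤ s → s ≤ t → t ≤ T → ∀ x y, 0 ≤ p s t x y
  sum_eq_one : ∀ s t, 0 ≤ s → s ≤ t → t ≤ T → ∀ x, ∑ y, p s t x y = 1
  initial : ∀ s, 0 ≤ s → s ≤ T → ∀ x y, p s s x y = if x = y then 1 else 0
  chapman_kolmogorov : ∀ s r t, 0 ≤ s → s ≤ r → r ≤ t → t ≤ T → ∀ x y,
    p s t x y = ∑ z, p s r x z * p r t z y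
  continuousOn : ∀ s, 0 ≤ s → s ≤ T → ∀ x y, ContinuousOn (fun t => p s t x y) (Icc s T)
  forward : ∀ s t, 0 ≤ s → s ≤ t → t ≤ T → ∀ (x : S) (φ : S → ℝ),
    ∑ y, p s t x y * φ y = φ x + ∫ r in s..t, ∑ z, p s r x z * L r φ z

/-- The law at time `t` of the chain with transition function `p` started at time `s` with
law `ν`. -/
def lawAt {S : Type*} [Fintype S] (p : ℝ → ℝ → S → S → ℝ) (s : ℝ) (ν : S → ℝ) (t : ℝ) (y : S) : ℝ :=
  ∑ x, ν x * p s t x y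

open Classical in
/-- The law concentrated at one state. -/
def diracLaw {S : Type*} (x : S) : S → ℝ := fun y => if y = x then 1 else 0

/-- The expected cost `E[∫_s^T c(t, X_t) dt + h(X_T)]` for the chain `X` with transition function
`p` started at time `s` with law `ν`, computed from the law of `X`
(see `expected_pathwise_cost`). -/
def expectedCost {S : Type*} [Fintype S] (p : ℝ → ℝ → S → S → ℝ) (s T : ℝ) (ν : S → ℝ)
    (c : ℝ → S → ℝ) (h : S → ℝ) : ℝ :=
  (∫ t in s..T, ∑ y, lawAt p s ν t y * c t y) + ∑ y, lawAt p s ν T y * h y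

/-- On every probability space that carries a (jointly measurable) process with the marginal laws
`lawAt p s ν`, the expectation of the pathwise cost is `expectedCost`. -/
theorem expected_pathwise_cost {S Ω : Type*} [Fintype S] [MeasurableSpace S]
    [DiscreteMeasurableSpace S] [MeasurableSpace Ω] (P : Measure Ω) [IsProbabilityMeasure P]
    (X : ℝ → Ω → S) (hX : Measurable (Function.uncurry X))
    (p : ℝ → ℝ → S → S → ℝ) (s T : ℝ) (hsT : s ≤ T) (ν : S → ℝ)
    (hlaw : ∀ t ∈ Icc s T, ∀ y, P.real {ω | X t ω = y} = lawAt p s ν t y)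
    (c : ℝ → S → ℝ) (hc : ∀ y, IntervalIntegrable (fun t => c t y) volume s T) (h : S → ℝ) :
    ∫ ω, ((∫ t in s..T, c t (X t ω)) + h (X T ω)) ∂P = expectedCost p s T ν c h := by
  classical
  set μ : Measure ℝ := volume.restrict (Ioc s T) with hμ
  have hmeas : ∀ y, MeasurableSet {z : ℝ × Ω | X z.1 z.2 = y} := fun y =>
    hX (MeasurableSet.of_discrete : MeasurableSet ({y} : Set S))
  have hmeas' : ∀ t y, MeasurableSet {ω : Ω | X t ω = y} := fun t y =>
    (hmeas y).preimage (measurable_prodMk_left (x := t))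
  have hsum : ∀ (k : S → ℝ) (t : ℝ) (ω : Ω),
      k (X t ω) = ∑ y, {ω' : Ω | X t ω' = y}.indicator (fun _ => k y) ω := by
    intro k t ω
    simp [Set.indicator_apply]
  have hcint : ∀ y, Integrable (fun t => c t y) μ := fun y =>
    (intervalIntegrable_iff_integrableOn_Ioc_of_le hsT).1 (hc y)
  have hint : ∀ y, Integrable
      (fun z : ℝ × Ω => {ω' : Ω | X z.1 ω' = y}.indicator (fun _ => c z.1 y) z.2) (μ.prod P) := by
    intro y
    have h1 : Integrable (fun z : ℝ × Ω => c z.1 y) (μ.prod P) := (hcint y).comp_fst P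
    refine (h1.indicator (hmeas y)).congr (Filter.Eventually.of_forall fun z => ?_)
    simp [Set.indicator_apply]
  have hint' : Integrable (fun z : ℝ × Ω => c z.1 (X z.1 z.2)) (μ.prod P) := by
    refine (integrable_finsetSum Finset.univ fun y _ => hint y).congr
      (Filter.Eventually.of_forall fun z => ?_)
    exact (hsum (fun y => c z.1 y) z.1 z.2).symm
  have hmean : ∀ (k : S → ℝ) (t : ℝ), t ∈ Icc s T →
      ∫ ω, k (X t ω) ∂P = ∑ y, lawAt p s ν t y * k y := by
    intro k t ht
    simp_rw [hsum k t]
    rw [integral_finsetSum _ fun y _ =>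
      (integrable_const (k y)).indicator (hmeas' t y)]
    refine Finset.sum_congr rfl fun y _ => ?_
    rw [integral_indicator_const _ (hmeas' t y), hlaw t ht y, smul_eq_mul]
  have hterm : Integrable (fun ω => h (X T ω)) P := by
    simp_rw [hsum h T]
    exact integrable_finsetSum _ fun y _ => (integrable_const (h y)).indicator (hmeas' T y)
  have hrun : Integrable (fun ω => ∫ t in s..T, c t (X t ω)) P := by
    simp_rw [intervalIntegral.integral_of_le hsT]
    exact hint'.integral_prod_right
  rw [integral_add hrun hterm, hmean h T ⟨hsT, le_rfl⟩, expectedCost]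
  congr 1
  simp_rw [intervalIntegral.integral_of_le hsT]
  rw [← integral_integral_swap (f := fun t ω => c t (X t ω)) hint']
  refine setIntegral_congr_fun measurableSet_Ioc fun t ht => ?_
  exact hmean (c t) t (Ioc_subset_Icc_self ht)

namespace ControlData

/-! ### The control problem for the empirical measure -/

/-- Feedback controls `α t i m`: measurable in time for every state `i` and every `m ∈ S_d^N`
(the values for `m` off `S_d^N` are never used). -/
def IsFeedback {d : ℕ} {A : Type*} [MeasurableSpace A] (N : ℕ)
    (α : ℝ → Fin d → StateVec d → A) : Prop :=
  ∀ i, ∀ m ∈ gridSimplex d N, Measurable (fun t => α t i m)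

open Classical in
/-- The generator of the empirical measure process under the feedback `α`:
`L_t φ(m) = N ∑ i j, m_i Q_{i,j}(t, α(t, i, m), m) (φ(m + (δ_j - δ_i) / N) - φ(m))`.
If `m + (δ_j - δ_i) / N ∉ S_d^N`, then `m_i = 0` and the value `0` put for `φ` there is
irrelevant. -/
def empGenerator {d : ℕ} {A : Type*} (D : ControlData d A) (N : ℕ)
    (α : ℝ → Fin d → StateVec d → A) (t : ℝ) (φ : gridSimplex d N → ℝ) (m : gridSimplex d N) : ℝ :=
  (N : ℝ) * ∑ i, ∑ j, m.1 i * D.Q i j t (α t i m.1) m.1 *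
    ((if hm : shift N m.1 i j ∈ gridSimplex d N then φ ⟨shift N m.1 i j, hm⟩ else 0) - φ m)

/-- Running cost `∑ i, m_i f^i(t, α(t, i, m), m)` under the feedback `α`. -/
def empRunningCost {d : ℕ} {A : Type*} (D : ControlData d A) (N : ℕ)
    (α : ℝ → Fin d → StateVec d → A) (t : ℝ) (m : gridSimplex d N) : ℝ :=
  ∑ i, m.1 i * D.f i t (α t i m.1) m.1

/-- Terminal cost `∑ i, m_i g^i(m)`. -/
def empTerminalCost {d : ℕ} {A : Type*} (D : ControlData d A) (N : ℕ)
    (m : gridSimplex d N) : ℝ :=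
  ∑ i, m.1 i * D.g i m.1

/-- `J` is the cost on `[s, T]` of the feedback `α` in the control problem for the empirical
measure, started at time `s` with law `ν`. -/
def IsEmpCost {d : ℕ} {A : Type*} (D : ControlData d A) (N : ℕ)
    (α : ℝ → Fin d → StateVec d → A) (s : ℝ) (ν : gridSimplex d N → ℝ) (J : ℝ) : Prop :=
  ∃ p, IsTransitionFunction D.T (D.empGenerator N α) p ∧
    J = expectedCost p s D.T ν (D.empRunningCost N α) (D.empTerminalCost N)

/-- The costs of all feedback controls in the control problem for the empirical measure. -/
def empCosts {d : ℕ} {A : Type*} [MeasurableSpace A] (D : ControlData d A) (N : ℕ)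
    (s : ℝ) (ν : gridSimplex d N → ℝ) : Set ℝ :=
  {J | ∃ α : ℝ → Fin d → StateVec d → A, IsFeedback N α ∧ D.IsEmpCost N α s ν J}

/-! ### The centralized control problem for `N` agents -/

/-- Feedback controls `β t x k` of the agents `k`, depending on the states `x` of all agents. -/
def IsAgentFeedback {d N : ℕ} {A : Type*} [MeasurableSpace A]
    (β : ℝ → (Fin N → Fin d) → Fin N → A) : Prop :=
  ∀ x k, Measurable (fun t => β t x k)

/-- The generator of the `N` agents under the feedback `β`:
`L_t φ(x) = ∑ k, ∑ j ≠ x_k, Q_{x_k,j}(t, β_k(t, x), μ^N_x) (φ([x^{-k}, j]) - φ(x))`. -/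
def agentGenerator {d N : ℕ} {A : Type*} (D : ControlData d A)
    (β : ℝ → (Fin N → Fin d) → Fin N → A) (t : ℝ) (φ : (Fin N → Fin d) → ℝ)
    (x : Fin N → Fin d) : ℝ :=
  ∑ k, ∑ j ∈ Finset.univ.erase (x k),
    D.Q (x k) j t (β t x k) (empirical x) * (φ (Function.update x k j) - φ x)

/-- Running cost `(1/N) ∑ k, f^{x_k}(t, β_k(t, x), μ^N_x)`. -/
def agentRunningCost {d N : ℕ} {A : Type*} (D : ControlData d A)
    (β : ℝ → (Fin N → Fin d) → Fin N → A) (t : ℝ) (x : Fin N → Fin d) : ℝ :=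
  (1 / (N : ℝ)) * ∑ k, D.f (x k) t (β t x k) (empirical x)

/-- Terminal cost `(1/N) ∑ k, g^{x_k}(μ^N_x)`. -/
def agentTerminalCost {d N : ℕ} {A : Type*} (D : ControlData d A) (x : Fin N → Fin d) : ℝ :=
  (1 / (N : ℝ)) * ∑ k, D.g (x k) (empirical x)

/-- `J` is the cost on `[s, T]` of the feedback `β` in the `N`-agent control problem, started at
time `s` with law `ν`. -/
def IsAgentCost {d N : ℕ} {A : Type*} (D : ControlData d A)
    (β : ℝ → (Fin N → Fin d) → Fin N → A) (s : ℝ) (ν : (Fin N → Fin d) → ℝ) (J : ℝ) : Prop :=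
  ∃ p, IsTransitionFunction D.T (D.agentGenerator β) p ∧
    J = expectedCost p s D.T ν (D.agentRunningCost β) D.agentTerminalCost

/-- The costs of all feedback controls in the `N`-agent control problem. -/
def agentCosts {d : ℕ} {A : Type*} [MeasurableSpace A] (D : ControlData d A) (N : ℕ)
    (s : ℝ) (ν : (Fin N → Fin d) → ℝ) : Set ℝ :=
  {J | ∃ β : ℝ → (Fin N → Fin d) → Fin N → A, IsAgentFeedback β ∧ D.IsAgentCost β s ν J}

/-- The mean field restriction `β_k(t, x) = α(t, x_k, μ^N_x)`. -/
def meanFieldFeedback {d N : ℕ} {A : Type*} (α : ℝ → Fin d → StateVec d → A) :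
    ℝ → (Fin N → Fin d) → Fin N → A :=
  fun t x k => α t (x k) (empirical x)

/-- The costs in the `N`-agent control problem of the feedback controls of mean field type. -/
def meanFieldAgentCosts {d : ℕ} {A : Type*} [MeasurableSpace A] (D : ControlData d A) (N : ℕ)
    (s : ℝ) (ν : (Fin N → Fin d) → ℝ) : Set ℝ :=
  {J | ∃ α : ℝ → Fin d → StateVec d → A,
    IsFeedback N α ∧ D.IsAgentCost (meanFieldFeedback α) s ν J}

end ControlData

/-- The law of `N` independent agents with common law `m₀`. -/
def iidLaw {d : ℕ} (N : ℕ) (m₀ : StateVec d) (x : Fin N → Fin d) : ℝ :=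
  ∏ k, m₀ (x k)

open Classical in
/-- The law of the empirical measure of `N` agents with joint law `ν`. -/
def empiricalLaw {d N : ℕ} (ν : (Fin N → Fin d) → ℝ) (m : gridSimplex d N) : ℝ :=
  ∑ x, if empirical x = m.1 then ν x else 0

end

/-! The weighted sum of the Hamiltonians `H^i` is a single maximum over joint actions `b ∈ A^d`,
because the `i`-th term depends only on `b i` (`jumpHamiltonian_eq`). The HJB system is thus the
dynamic programming equation of a controlled jump process on the finite grid, with joint action
space `A^d`. In this form only the continuity of `F` matters, not that of the single `f^i`. The
equation is an ODE with right-hand side continuous in time and globally Lipschitz in the unknown, so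
Picard iteration solves it; a maximum principle gives uniqueness.

The values are identified by verification. Dynkin's formula writes the cost of a feedback as the
mean of `V` under the initial law plus the time integral of the mean of running cost plus generator
applied to `V` plus time derivative of `V`. The HJB equation makes this integrand nonnegative for
every feedback, and zero for a feedback that selects a maximizer measurably in time. For `N` agents
the same computation is made with `V` composed with `empirical`: the jump of one agent shifts the
empirical measure, and each agent's own action competes in the Hamiltonian of its state. Hence
nothing is gained by agents in the same state acting differently, and the mean field version of the
optimal feedback attains the bound. All this holds for any initial law, which covers both Dirac and
i.i.d. starts.

The Lipschitz bound comes from doubling variables: at a maximum over pairs `(m, p)` of `V(t,p) -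
V(t,m) - K(t)|p - m|` both points are moved in the same direction, which leaves `p - m` unchanged.
Only the difference of the rates remains, of order `N|p - m|`, against increments of order `K/N`.
The factors `N` cancel (`hjb_sub_le`). -/

/-! ### Grönwall, integral equations and a comparison principle -/

theorem nonpos_of_le_mul_integral {n : ℝ → ℝ} {K s b : ℝ} (hK : 0 ≤ K)
    (hn : ContinuousOn n (Icc s b))
    (h : ∀ t ∈ Icc s b, n t ≤ K * ∫ r in s..t, n r) : ∀ t ∈ Icc s b, n t ≤ 0 := by
  intro t₀ ht₀
  have hsb : s ≤ b := ht₀.1.trans ht₀.2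
  -- The constant extension beyond the end points makes the primitive differentiable everywhere;
  -- Grönwall's inequality is then applied to the primitive, so no sign of `n` is needed.
  set n' : ℝ → ℝ := IccExtend hsb ((Icc s b).domRestrict n) with hn'
  have hn'c : Continuous n' := (continuousOn_iff_continuous_domRestrict.1 hn).Icc_extend'
  have heq : ∀ t ∈ Icc s b, n' t = n t := fun t ht => by
    rw [hn', IccExtend_of_mem hsb _ ht]; rfl
  have hint : ∀ t ∈ Icc s b, ∫ r in s..t, n r = ∫ r in s..t, n' r := fun t ht => by
    refine intervalIntegral.integral_congr fun r hr => ?_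
    rw [uIcc_of_le ht.1] at hr
    exact (heq r ⟨hr.1, hr.2.trans ht.2⟩).symm
  have hder : ∀ t, HasDerivAt (fun t => ∫ r in s..t, n' r) (n' t) t := fun t =>
    intervalIntegral.integral_hasDerivAt_right (hn'c.intervalIntegrable _ _)
      (hn'c.stronglyMeasurableAtFilter _ _) hn'c.continuousAt
  have hG := le_gronwallBound_of_liminf_deriv_right_le (f := fun t => ∫ r in s..t, n' r) (f' := n')
    (δ := 0) (K := K) (ε := 0) (a := s) (b := b)
    (fun t _ => (hder t).continuousAt.continuousWithinAt)
    (fun t _ r hr => by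
      have := (hder t).hasDerivWithinAt (s := Ici t) |>.liminf_right_slope_le hr
      simpa [slope_def_field, div_eq_inv_mul] using this) (by simp)
    (fun t ht => by
      have ht' := Ico_subset_Icc_self ht
      rw [heq t ht', add_zero, ← hint t ht']
      exact h t ht') t₀ ht₀
  rw [gronwallBound_ε0_δ0] at hG
  refine (h t₀ ht₀).trans ?_
  rw [hint t₀ ht₀]
  exact mul_nonpos_of_nonneg_of_nonpos hK hG

/-- Integration by parts for absolutely continuous functions. Integrability of `h` and `k` must
suffice, since feedbacks, and hence the rates, are only measurable in time. -/
theorem mul_eq_add_integral {f g h k : ℝ → ℝ} {s b f₀ g₀ : ℝ} (hsb : s ≤ b)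
    (hh : IntervalIntegrable h volume s b) (hk : IntervalIntegrable k volume s b)
    (hf : ∀ t ∈ Icc s b, f t = f₀ + ∫ r in s..t, h r)
    (hg : ∀ t ∈ Icc s b, g t = g₀ + ∫ r in s..t, k r) :
    f b * g b = f₀ * g₀ + ∫ r in s..b, (h r * g r + f r * k r) := by
  set F : ℝ → ℝ := fun t => ∫ r in s..t, h r
  set G : ℝ → ℝ := fun t => ∫ r in s..t, k r
  have hF : AbsolutelyContinuousOnInterval F s b :=
    hh.absolutelyContinuousOnInterval_intervalIntegral (by simp)
  have hG : AbsolutelyContinuousOnInterval G s b :=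
    hk.absolutelyContinuousOnInterval_intervalIntegral (by simp)
  have key := hF.integral_deriv_mul_eq_sub hG
  have hF0 : F s = 0 := by simp [F]
  have hG0 : G s = 0 := by simp [G]
  have hb : b ∈ Icc s b := ⟨hsb, le_rfl⟩
  -- By Lebesgue differentiation the primitives have derivatives `h` and `k` almost everywhere.
  have hae : ∫ r in s..b, (h r * g r + f r * k r)
      = ∫ r in s..b, (deriv F r * G r + F r * deriv G r) + (g₀ * h r + f₀ * k r) := by
    apply intervalIntegral.integral_congr_ae
    filter_upwards [hh.ae_hasDerivAt_integral, hk.ae_hasDerivAt_integral] with r h1 h2 hr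
    have hr' : r ∈ uIcc s b := uIoc_subset_uIcc hr
    have h1' : deriv F r = h r := (h1 hr' s (by simp)).deriv
    have h2' : deriv G r = k r := (h2 hr' s (by simp)).deriv
    rw [uIcc_of_le hsb] at hr'
    rw [h1', h2', hf r hr', hg r hr']
    simp only [F, G]
    ring
  rw [hae, intervalIntegral.integral_add
    ((hF.intervalIntegrable_deriv.mul_continuousOn hG.continuousOn).add
      (hG.intervalIntegrable_deriv.continuousOn_mul hF.continuousOn))
    ((hh.const_mul _).add (hk.const_mul _)), key,
    intervalIntegral.integral_add (hh.const_mul _) (hk.const_mul _),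
    intervalIntegral.integral_const_mul, intervalIntegral.integral_const_mul,
    hf b hb, hg b hb, hF0, hG0]
  simp only [F, G]
  ring

/-- Global existence for ODEs in integrated form, with a right-hand side that is Lipschitz in the
unknown and only integrable in time. -/
theorem exists_integral_solution {E : Type*} [NormedAddCommGroup E] [NormedSpace ℝ E]
    [CompleteSpace E] {Φ : ℝ → E → E} {K s b : ℝ} (hsb : s ≤ b) (hK : 0 ≤ K)
    (hint : ∀ u : ℝ → E, Continuous u → ∀ t ∈ Icc s b,
      IntervalIntegrable (fun r => Φ r (u r)) volume s t)
    (hlip : ∀ t ∈ Icc s b, ∀ x y, ‖Φ t x - Φ t y‖ ≤ K * ‖x - y‖) (x₀ : E) :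
    ∃ u : ℝ → E, Continuous u ∧ ∀ t ∈ Icc s b, u t = x₀ + ∫ r in s..t, Φ r (u r) := by
  have hne : Nonempty (Icc s b) := ⟨⟨s, le_rfl, hsb⟩⟩
  set ext : C(Icc s b, E) → ℝ → E := fun u => IccExtend hsb u with hext
  have hextc : ∀ u, Continuous (ext u) := fun u => u.continuous.Icc_extend'
  have hexte : ∀ u (t : Icc s b), ext u t = u t := fun u t => by
    simp [hext]
  have hdist : ∀ u v t, ‖ext u t - ext v t‖ ≤ dist u v := fun u v t => by
    rw [← dist_eq_norm]; exact ContinuousMap.dist_apply_le_dist _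
  set P : C(Icc s b, E) → C(Icc s b, E) := fun u =>
    ⟨fun t => x₀ + ∫ r in s..(t : ℝ), Φ r (ext u r), by
      have h1 := (hint (ext u) (hextc u) b ⟨hsb, le_rfl⟩)
      have h2 := intervalIntegral.continuousOn_primitive_interval' h1 (a := s) (by simp)
      rw [uIcc_of_le hsb] at h2
      exact continuous_const.add (continuousOn_iff_continuous_domRestrict.1 h2)⟩ with hP
  -- Iterating the Picard map integrates the polynomial bound once more each time; the factorial
  -- removes any smallness condition on the interval.
  have hiter : ∀ (n : ℕ) u v (t : Icc s b), ‖P^[n] u t - P^[n] v t‖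
      ≤ (K * (t - s)) ^ n / n.factorial * dist u v := by
    intro n u v
    induction n with
    | zero =>
      intro t
      rw [← hexte, ← hexte]
      simpa using hdist u v t
    | succ n ih =>
      intro t
      rw [Function.iterate_succ_apply', Function.iterate_succ_apply']
      have e1 : P (P^[n] u) t - P (P^[n] v) t
          = ∫ r in s..(t : ℝ), (Φ r (ext (P^[n] u) r) - Φ r (ext (P^[n] v) r)) := by
        rw [intervalIntegral.integral_sub (hint _ (hextc _) _ t.2) (hint _ (hextc _) _ t.2)]
        simp [hP]
      rw [e1]
      have e2 : ‖∫ r in s..(t : ℝ), (Φ r (ext (P^[n] u) r) - Φ r (ext (P^[n] v) r))‖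
          ≤ ∫ r in s..(t : ℝ), K * ((K * (r - s)) ^ n / n.factorial * dist u v) := by
        apply intervalIntegral.norm_integral_le_of_norm_le t.2.1
        · refine Filter.Eventually.of_forall fun r hr => ?_
          have hr' : r ∈ Icc s b := ⟨hr.1.le, hr.2.trans t.2.2⟩
          refine (hlip r hr' _ _).trans (mul_le_mul_of_nonneg_left ?_ hK)
          have := ih ⟨r, hr'⟩
          rwa [← hexte, ← hexte] at this
        · exact Continuous.intervalIntegrable (by fun_prop) _ _
      refine e2.trans (le_of_eq ?_)
      have e3 : ∀ r, K * ((K * (r - s)) ^ n / n.factorial * dist u v)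
          = (K ^ (n + 1) / n.factorial * dist u v) * (r - s) ^ n := fun r => by
        rw [mul_pow]; ring
      simp_rw [e3]
      rw [intervalIntegral.integral_const_mul,
        intervalIntegral.integral_comp_sub_right (fun r => r ^ n) s, integral_pow,
        Nat.factorial_succ]
      push_cast
      have : (n.factorial : ℝ) ≠ 0 := by positivity
      rw [mul_pow]
      field_simp
      ring
  -- Some iterate is a contraction, although the Picard map itself need not be; the fixed point of
  -- the iterate is also fixed by the map.
  obtain ⟨n, hn⟩ := FloorSemiring.tendsto_pow_div_factorial_atTop (K * (b - s))
    |>.eventually (gt_mem_nhds zero_lt_one) |>.exists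
  have hb0 : 0 ≤ K * (b - s) := mul_nonneg hK (sub_nonneg.2 hsb)
  have hc0 : (0 : ℝ) ≤ (K * (b - s)) ^ n / n.factorial := by positivity
  have hcontr : ContractingWith (Real.toNNReal ((K * (b - s)) ^ n / n.factorial)) P^[n] := by
    refine ⟨by rwa [Real.toNNReal_lt_one], LipschitzWith.of_dist_le_mul fun u v => ?_⟩
    rw [Real.coe_toNNReal _ hc0, ContinuousMap.dist_le (mul_nonneg hc0 dist_nonneg)]
    intro t
    rw [dist_eq_norm]
    refine (hiter n u v t).trans (mul_le_mul_of_nonneg_right ?_ dist_nonneg)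
    have := t.2.2
    have := t.2.1
    have h0 : 0 ≤ K * ((t : ℝ) - s) := mul_nonneg hK (by linarith)
    gcongr
  have hfix := hcontr.isFixedPt_fixedPoint_iterate
  set u := ContractingWith.fixedPoint P^[n] hcontr
  refine ⟨ext u, hextc u, fun t ht => ?_⟩
  have := congrArg (fun w : C(Icc s b, E) => w ⟨t, ht⟩) hfix
  simp only [hP, ContinuousMap.coe_mk] at this
  rw [this, hexte u ⟨t, ht⟩]

/-- Comparison principle: `w ≤ 0` at the final time propagates backwards if `w` is nondecreasing in
time at its spatial maximizers. -/
theorem nonpos_of_deriv_nonneg_at_max {S : Type*} [Finite S] {T : ℝ} {w w' : ℝ → S → ℝ}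
    (hw : ∀ t ∈ Icc 0 T, ∀ x, HasDerivWithinAt (fun s => w s x) (w' t x) (Icc 0 T) t)
    (hmax : ∀ t ∈ Icc 0 T, ∀ x, (∀ y, w t y ≤ w t x) → 0 ≤ w' t x)
    (hT : ∀ x, w T x ≤ 0) : ∀ t ∈ Icc 0 T, ∀ x, w t x ≤ 0 := by
  intro t₁ ht₁ x₁
  have h0T : 0 ≤ T := ht₁.1.trans ht₁.2
  refine le_of_forall_pos_le_add fun ε hε => ?_
  -- Adding `δ * t` makes the time derivative at a spatial maximizer strictly positive. The
  -- denominator `T + 1` keeps `δ * T ≤ ε` and allows `T = 0`.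
  have hδ : 0 < ε / (T + 1) := by positivity
  set δ := ε / (T + 1) with hδd
  let _ : TopologicalSpace S := ⊥
  have : DiscreteTopology S := ⟨rfl⟩
  have hcont : ContinuousOn (fun z : ℝ × S => w z.1 z.2 + δ * z.1) (Icc 0 T ×ˢ univ) := by
    refine ContinuousOn.add ?_ (by fun_prop)
    rintro ⟨t, x⟩ ⟨ht, -⟩
    have h1 := (hw t ht x).continuousWithinAt
    rw [ContinuousWithinAt, nhdsWithin_prod_eq, nhdsWithin_univ, nhds_discrete]
    have : Filter.Tendsto (fun z : ℝ × S => w z.1 x) (nhdsWithin t (Icc 0 T) ×ˢ pure x)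
        (nhds (w t x)) := h1.tendsto.comp Filter.tendsto_fst
    refine this.congr' ?_
    rw [Filter.prod_pure, Filter.EventuallyEq, Filter.eventually_map]
    exact Filter.Eventually.of_forall fun _ => rfl
  obtain ⟨⟨t, x⟩, ⟨ht, -⟩, hM⟩ := (isCompact_Icc.prod (isCompact_univ (X := S))).exists_isMaxOn
    ⟨(t₁, x₁), ht₁, mem_univ _⟩ hcont
  have hM' : ∀ s ∈ Icc 0 T, ∀ y, w s y + δ * s ≤ w t x + δ * t := fun s hs y =>
    hM (show (s, y) ∈ Icc 0 T ×ˢ univ from ⟨hs, mem_univ _⟩)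
  have hder := (hw t ht x).add ((hasDerivWithinAt_id t (Icc 0 T)).const_mul δ)
  have hpos : 0 < w' t x + δ * 1 := by
    have := hmax t ht x fun y => by linarith [hM' t ht y]
    linarith
  -- A strictly positive right derivative would give larger values just after `t`, so the maximum
  -- over time and space sits at the final time.
  have htT : t = T := by
    by_contra hne
    have hlt : t < T := lt_of_le_of_ne ht.2 hne
    have hder' := hder.mono (Icc_subset_Icc_left ht.1)
    have h1 : HasDerivWithinAt _ _ (Ici t) t :=
      hder'.mono_of_mem_nhdsWithin (Icc_mem_nhdsGE hlt)
    have h2 := (hasDerivWithinAt_iff_tendsto_slope.1 h1)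
    rw [Ici_sdiff_left] at h2
    have h3 := h2.eventually (lt_mem_nhds hpos)
    have h4 : ∀ᶠ z in nhdsWithin t (Ioi t), z ∈ Ioc t T := Ioc_mem_nhdsGT hlt
    obtain ⟨z, hz, hz'⟩ := (h3.and h4).exists
    rw [slope_def_field, lt_div_iff₀ (sub_pos.2 hz'.1)] at hz
    have := hM' z ⟨ht.1.trans hz'.1.le, hz'.2⟩ x
    simp only [Pi.add_apply, id] at hz
    linarith
  subst htT
  have h1 := hM' t₁ ht₁ x₁
  have h2 := hT x
  have h3 : δ * t ≤ ε := by
    rw [hδd, div_mul_eq_mul_div, div_le_iff₀ (by linarith)]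
    nlinarith
  have h4 : 0 ≤ δ * t₁ := mul_nonneg hδ.le ht₁.1
  linarith

/-- Bounded measurable time-dependent `Q`-matrices on a finite set. -/
structure IsRateMatrix {S : Type*} [Fintype S] (M : ℝ) (G : ℝ → S → S → ℝ) : Prop where
  measurable : ∀ x y, Measurable fun t => G t x y
  bound : ∀ t x y, |G t x y| ≤ M
  nonneg : ∀ t x y, x ≠ y → 0 ≤ G t x y
  sum_eq_zero : ∀ t x, ∑ y, G t x y = 0

/-! ### Linear integral equations with bounded measurable coefficients -/

section Linear

variable {S : Type*} [Fintype S]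

theorem intervalIntegrable_sum_mul {u : ℝ → S → ℝ} {G : ℝ → S → S → ℝ} {M s b : ℝ} (hsb : s ≤ b)
    (hG : ∀ x y, Measurable fun t => G t x y) (hM : ∀ t x y, |G t x y| ≤ M)
    (hu : ∀ y, ContinuousOn (fun t => u t y) (Icc s b)) (y : S) :
    IntervalIntegrable (fun r => ∑ z, u r z * G r z y) volume s b := by
  have : (fun r => ∑ z, u r z * G r z y) = ∑ z, fun r => u r z * G r z y := by
    ext r; simp
  rw [this]
  refine IntervalIntegrable.sum _ fun z _ => ?_
  refine IntervalIntegrable.continuousOn_mul ?_ (by rw [uIcc_of_le hsb]; exact hu z)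
  rw [intervalIntegrable_iff]
  exact Measure.integrableOn_of_bounded (M := M) (by simp) (hG z y).aestronglyMeasurable
    (Filter.Eventually.of_forall fun t => hM t z y)

/-- Grönwall applied to the `ℓ¹` distance of the two solutions. -/
theorem linear_integral_unique {u v : ℝ → S → ℝ} {u₀ : S → ℝ} {G : ℝ → S → S → ℝ} {M s b : ℝ}
    (hM0 : 0 ≤ M) (hG : ∀ x y, Measurable fun t => G t x y) (hM : ∀ t x y, |G t x y| ≤ M)
    (huc : ∀ y, ContinuousOn (fun t => u t y) (Icc s b))
    (hvc : ∀ y, ContinuousOn (fun t => v t y) (Icc s b))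
    (hu : ∀ t ∈ Icc s b, ∀ y, u t y = u₀ y + ∫ r in s..t, ∑ z, u r z * G r z y)
    (hv : ∀ t ∈ Icc s b, ∀ y, v t y = u₀ y + ∫ r in s..t, ∑ z, v r z * G r z y) :
    ∀ t ∈ Icc s b, ∀ y, u t y = v t y := by
  have hnc : ContinuousOn (fun t => ∑ y, |u t y - v t y|) (Icc s b) :=
    continuousOn_finsetSum _ fun y _ => ((huc y).sub (hvc y)).abs
  have key := nonpos_of_le_mul_integral (n := fun t => ∑ y, |u t y - v t y|) (s := s) (b := b)
    (K := Fintype.card S * M) (by positivity) hnc ?_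
  · intro t ht y
    have h1 := key t ht
    have h2 := Finset.single_le_sum (f := fun y => |u t y - v t y|)
      (fun y _ => abs_nonneg _) (Finset.mem_univ y)
    exact sub_eq_zero.1 (abs_nonpos_iff.1 (h2.trans h1))
  · intro t ht
    have hsub : Icc s t ⊆ Icc s b := Icc_subset_Icc_right ht.2
    have h1 : ∀ y, |u t y - v t y| ≤ M * ∫ r in s..t, ∑ z, |u r z - v r z| := by
      intro y
      rw [hu t ht y, hv t ht y, add_sub_add_left_eq_sub, ← intervalIntegral.integral_sub
        (intervalIntegrable_sum_mul ht.1 hG hM (fun y => (huc y).mono hsub) y)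
        (intervalIntegrable_sum_mul ht.1 hG hM (fun y => (hvc y).mono hsub) y),
        ← intervalIntegral.integral_const_mul, ← Real.norm_eq_abs]
      refine intervalIntegral.norm_integral_le_of_norm_le ht.1
        (Filter.Eventually.of_forall fun r _ => ?_)
        (((hnc.mono (by rwa [uIcc_of_le ht.1])).intervalIntegrable).const_mul _)
      rw [← Finset.sum_sub_distrib, Finset.mul_sum]
      refine (Finset.abs_sum_le_sum_abs _ _).trans (Finset.sum_le_sum fun z _ => ?_)
      rw [← sub_mul, abs_mul, mul_comm]
      exact mul_le_mul_of_nonneg_right (hM r z y) (abs_nonneg _)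
    refine (Finset.sum_le_sum fun y _ => h1 y).trans ?_
    simp [mul_assoc]

/-- Grönwall applied to the sum of the negative parts: as `B` is nonnegative, `-u * B` is at most
the negative part of `u` times `B`, so only negative parts can create negative values. -/
theorem linear_integral_nonneg {u : ℝ → S → ℝ} {u₀ : S → ℝ} {B : ℝ → S → S → ℝ} {M s b : ℝ}
    (hM0 : 0 ≤ M) (hB : ∀ x y, Measurable fun t => B t x y) (hM : ∀ t x y, |B t x y| ≤ M)
    (hB0 : ∀ t x y, 0 ≤ B t x y) (hu₀ : ∀ y, 0 ≤ u₀ y)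
    (huc : ∀ y, ContinuousOn (fun t => u t y) (Icc s b))
    (hu : ∀ t ∈ Icc s b, ∀ y, u t y = u₀ y + ∫ r in s..t, ∑ z, u r z * B r z y) :
    ∀ t ∈ Icc s b, ∀ y, 0 ≤ u t y := by
  have hnc : ContinuousOn (fun t => ∑ y, max (-u t y) 0) (Icc s b) :=
    continuousOn_finsetSum _ fun y _ => ContinuousOn.sup (huc y).neg continuousOn_const
  have key := nonpos_of_le_mul_integral (n := fun t => ∑ y, max (-u t y) 0) (s := s) (b := b)
    (K := Fintype.card S * M) (by positivity) hnc ?_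
  · intro t ht y
    have h1 := key t ht
    have h2 := Finset.single_le_sum (f := fun y => max (-u t y) 0)
      (fun y _ => le_max_right _ _) (Finset.mem_univ y)
    linarith [le_max_left (-u t y) 0]
  · intro t ht
    have hsub : Icc s t ⊆ Icc s b := Icc_subset_Icc_right ht.2
    have hi : IntervalIntegrable (fun r => ∑ z, max (-u r z) 0) volume s t :=
      (hnc.mono (by rwa [uIcc_of_le ht.1])).intervalIntegrable
    have h1 : ∀ y, max (-u t y) 0 ≤ M * ∫ r in s..t, ∑ z, max (-u r z) 0 := by
      intro y
      refine max_le ?_ (mul_nonneg hM0 (intervalIntegral.integral_nonneg ht.1 fun r _ =>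
        Finset.sum_nonneg fun z _ => le_max_right _ _))
      rw [hu t ht y, neg_add, ← intervalIntegral.integral_neg,
        ← intervalIntegral.integral_const_mul]
      have : ∫ r in s..t, -∑ z, u r z * B r z y
          ≤ ∫ r in s..t, M * ∑ z, max (-u r z) 0 := by
        refine intervalIntegral.integral_mono_on ht.1
          (intervalIntegrable_sum_mul ht.1 hB hM (fun y => (huc y).mono hsub) y).neg
          (hi.const_mul M) fun r _ => ?_
        rw [← Finset.sum_neg_distrib, Finset.mul_sum]
        refine Finset.sum_le_sum fun z _ => ?_
        have hz := hB0 r z y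
        have hz' := (le_abs_self _).trans (hM r z y)
        rw [← neg_mul]
        calc -u r z * B r z y ≤ max (-u r z) 0 * B r z y :=
              mul_le_mul_of_nonneg_right (le_max_left _ _) hz
          _ ≤ max (-u r z) 0 * M := mul_le_mul_of_nonneg_left hz' (le_max_right _ _)
          _ = _ := mul_comm _ _
      linarith [hu₀ y]
    refine (Finset.sum_le_sum fun y _ => h1 y).trans ?_
    simp [mul_assoc]

theorem exists_linear_integral_solution {G : ℝ → S → S → ℝ} {M s b : ℝ} (hsb : s ≤ b)
    (hM0 : 0 ≤ M) (hG : ∀ x y, Measurable fun t => G t x y) (hM : ∀ t x y, |G t x y| ≤ M)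
    (u₀ : S → ℝ) : ∃ u : ℝ → S → ℝ, (∀ y, Continuous fun t => u t y) ∧
      ∀ t ∈ Icc s b, ∀ y, u t y = u₀ y + ∫ r in s..t, ∑ z, u r z * G r z y := by
  have hint : ∀ u : ℝ → S → ℝ, Continuous u → ∀ t ∈ Icc s b,
      IntervalIntegrable (fun r y => ∑ z, u r z * G r z y) volume s t := by
    intro u hu t ht
    have h1 : ∀ y, IntervalIntegrable (fun r => ∑ z, u r z * G r z y) volume s t := fun y =>
      intervalIntegrable_sum_mul ht.1 hG hM
        (fun y => ((continuous_apply y).comp hu).continuousOn) y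
    rw [intervalIntegrable_iff]
    exact Integrable.of_eval fun y => (intervalIntegrable_iff.1 (h1 y))
  obtain ⟨u, huc, hu⟩ := exists_integral_solution
    (Φ := fun r (w : S → ℝ) y => ∑ z, w z * G r z y) (K := Fintype.card S * M)
    hsb (by positivity) hint (fun t _ x y => by
      rw [pi_norm_le_iff_of_nonneg (by positivity)]
      intro i
      rw [Pi.sub_apply, ← Finset.sum_sub_distrib]
      refine (Finset.abs_sum_le_sum_abs _ _).trans ?_
      refine (Finset.sum_le_sum (g := fun _ => M * ‖x - y‖) fun z _ => ?_).trans ?_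
      · rw [← sub_mul, abs_mul, mul_comm]
        exact mul_le_mul (hM t z i) (norm_le_pi_norm (x - y) z) (abs_nonneg _) hM0
      · simp [mul_assoc]) u₀
  refine ⟨u, fun y => (continuous_apply y).comp huc, fun t ht y => ?_⟩
  rw [hu t ht, Pi.add_apply]
  congr 1
  exact (ContinuousLinearMap.intervalIntegral_comp_comm
    (ContinuousLinearMap.proj (R := ℝ) (φ := fun _ : S => ℝ) y) (hint u huc t ht)).symm

end Linear

/-! ### Transition functions and Dynkin's formula -/

section Chain

variable {S : Type*} [Fintype S]

theorem IsTransitionFunction.congr {T : ℝ} {L L' : ℝ → (S → ℝ) → S → ℝ}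
    {p : ℝ → ℝ → S → S → ℝ} (h : IsTransitionFunction T L p)
    (hL : ∀ t ∈ Icc 0 T, ∀ φ x, L t φ x = L' t φ x) : IsTransitionFunction T L' p where
  nonneg := h.nonneg
  sum_eq_one := h.sum_eq_one
  initial := h.initial
  chapman_kolmogorov := h.chapman_kolmogorov
  continuousOn := h.continuousOn
  forward s t hs hst ht x φ := by
    rw [h.forward s t hs hst ht x φ]
    congr 1
    refine intervalIntegral.integral_congr fun r hr => Finset.sum_congr rfl fun z _ => ?_
    rw [uIcc_of_le hst] at hr
    rw [hL r ⟨hs.trans hr.1, hr.2.trans ht⟩]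

theorem diracLaw_comm {S : Type*} (x y : S) : diracLaw x y = diracLaw y x := by
  by_cases h : x = y
  · rw [h]
  · simp [diracLaw, h, Ne.symm h]

theorem sum_diracLaw_mul (x : S) (φ : S → ℝ) : ∑ y, diracLaw x y * φ y = φ x := by
  classical
  rw [Finset.sum_eq_single x (fun y _ h => by simp [diracLaw, h]) (by simp)]
  simp [diracLaw]

theorem sum_mul_diracLaw (y : S) (φ : S → ℝ) : ∑ x, φ x * diracLaw x y = φ y := by
  rw [← sum_diracLaw_mul y φ]
  exact Finset.sum_congr rfl fun x _ => by rw [diracLaw_comm, mul_comm]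

variable {M T : ℝ} {G : ℝ → S → S → ℝ} {p : ℝ → ℝ → S → S → ℝ}

/-- A negative `M` can occur only for empty `S`; passing to `|M|` avoids the case distinction. -/
theorem IsRateMatrix.exists_bound (hG : IsRateMatrix M G) : IsRateMatrix |M| G :=
  ⟨hG.measurable, fun t x y => (hG.bound t x y).trans (le_abs_self M), hG.nonneg, hG.sum_eq_zero⟩

/-- The forward equation tested with the indicator of `y` is a linear integral equation for each row
of `p`. Existence and uniqueness of transition functions reduce to that equation. -/
theorem IsTransitionFunction.kernel_eq
    (hp : IsTransitionFunction T (fun t φ x => ∑ y, G t x y * φ y) p) {s t : ℝ} (hs : 0 ≤ s)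
    (hst : s ≤ t) (ht : t ≤ T) (x y : S) :
    p s t x y = diracLaw x y + ∫ r in s..t, ∑ z, p s r x z * G r z y := by
  have h := hp.forward s t hs hst ht x (diracLaw y)
  have e : ∀ φ : S → ℝ, ∑ z, φ z * diracLaw y z = φ y := fun φ => by
    simp_rw [fun z : S => diracLaw_comm y z, sum_mul_diracLaw]
  simp only [e] at h
  rw [h, diracLaw_comm]

theorem IsRateMatrix.transition_unique (hG : IsRateMatrix M G) {p' : ℝ → ℝ → S → S → ℝ}
    (hp : IsTransitionFunction T (fun t φ x => ∑ y, G t x y * φ y) p)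
    (hp' : IsTransitionFunction T (fun t φ x => ∑ y, G t x y * φ y) p')
    {s t : ℝ} (hs : 0 ≤ s) (hst : s ≤ t) (ht : t ≤ T) : p s t = p' s t := by
  ext x y
  exact linear_integral_unique (u := fun t y => p s t x y) (v := fun t y => p' s t x y)
    (abs_nonneg M) hG.measurable hG.exists_bound.bound
    (hp.continuousOn s hs (hst.trans ht) x) (hp'.continuousOn s hs (hst.trans ht) x)
    (fun t ht y => hp.kernel_eq hs ht.1 ht.2 x y)
    (fun t ht y => hp'.kernel_eq hs ht.1 ht.2 x y) t ⟨hst, ht⟩ y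

theorem IsRateMatrix.exists_transition (hG : IsRateMatrix M G) (T : ℝ) :
    ∃ p, IsTransitionFunction T (fun t φ x => ∑ y, G t x y * φ y) p := by
  classical
  have hG' := hG.exists_bound
  set lam := |M| with hlam
  have hex : ∀ (s : ℝ) (x : S), ∃ u : ℝ → S → ℝ, s ≤ T → (∀ y, Continuous fun t => u t y) ∧
      ∀ t ∈ Icc s T, ∀ y, u t y = diracLaw x y + ∫ r in s..t, ∑ z, u r z * G r z y := by
    intro s x
    by_cases hs : s ≤ T
    · obtain ⟨u, hu⟩ := exists_linear_integral_solution hs (abs_nonneg M) hG'.measurable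
        hG'.bound (diracLaw x)
      exact ⟨u, fun _ => hu⟩
    · exact ⟨0, fun h => absurd h hs⟩
  choose u hu using hex
  have huc : ∀ s ≤ T, ∀ x y, Continuous fun t => u s x t y := fun s hs x => (hu s x hs).1
  have hint : ∀ s ≤ T, ∀ t ∈ Icc s T, ∀ x y,
      IntervalIntegrable (fun r => ∑ z, u s x r z * G r z y) volume s t := fun s hs t ht x y =>
    intervalIntegrable_sum_mul ht.1 hG'.measurable hG'.bound
      (fun y => (huc s hs x y).continuousOn) y
  refine ⟨fun s t x y => u s x t y, ?_, ?_, ?_, ?_, ?_, ?_⟩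
  · intro s t hs hst ht x y
    have hsT := hst.trans ht
    -- The factor `exp (lam * t)` adds `lam` to the diagonal of the rate matrix, so that all entries
    -- of the new matrix `B` are nonnegative and positivity is preserved.
    set q : ℝ → S → ℝ := fun t y => Real.exp (lam * t) * u s x t y with hq
    have hqc : ∀ y, ContinuousOn (fun t => q t y) (Icc s T) := fun y =>
      (Continuous.mul (by fun_prop) (huc s hsT x y)).continuousOn
    set B : ℝ → S → S → ℝ := fun t x y => G t x y + if x = y then lam else 0 with hB
    have hBm : ∀ x y, Measurable fun t => B t x y := fun x y => (hG.measurable x y).add_const _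
    have hBb : ∀ t x y, |B t x y| ≤ lam + lam := fun t x y => by
      refine (abs_add_le _ _).trans (add_le_add (hG'.bound t x y) ?_)
      split_ifs
      · exact (abs_abs M).le
      · simp [hlam]
    have hB0 : ∀ t x y, 0 ≤ B t x y := fun t x y => by
      by_cases hxy : x = y
      · simp only [hB, hxy, if_true]
        linarith [(abs_le.1 (hG'.bound t y y)).1]
      · simpa [hB, hxy] using hG.nonneg t x y hxy
    have hqe : ∀ t ∈ Icc s T, ∀ y, q t y = Real.exp (lam * s) * diracLaw x y
        + ∫ r in s..t, ∑ z, q r z * B r z y := by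
      intro t ht y
      have hder : ∀ t, HasDerivAt (fun t => Real.exp (lam * t)) (lam * Real.exp (lam * t)) t := by
        intro t
        have := ((hasDerivAt_id t).const_mul lam).exp
        simpa [mul_comm] using this
      have hic : Continuous fun t => lam * Real.exp (lam * t) := by fun_prop
      have h := mul_eq_add_integral (f := fun t => Real.exp (lam * t)) (g := fun t => u s x t y)
        (h := fun t => lam * Real.exp (lam * t)) (k := fun r => ∑ z, u s x r z * G r z y)
        (f₀ := Real.exp (lam * s)) (g₀ := diracLaw x y)
        ht.1 (hic.intervalIntegrable _ _) (hint s hsT t ht x y)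
        (fun t _ => by
          rw [intervalIntegral.integral_eq_sub_of_hasDerivAt (fun t _ => hder t)
            (hic.intervalIntegrable _ _)]
          ring)
        (fun r hr => (hu s x hsT).2 r ⟨hr.1, hr.2.trans ht.2⟩ y)
      rw [hq]
      simp only
      rw [h]
      congr 1
      refine intervalIntegral.integral_congr fun r _ => ?_
      simp only [hB, mul_add, Finset.sum_add_distrib, mul_ite, mul_zero, Finset.sum_ite_eq',
        Finset.mem_univ, if_true, Finset.mul_sum]
      rw [add_comm]
      congr 1
      · exact Finset.sum_congr rfl fun z _ => by ring
      · ring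
    have := linear_integral_nonneg (by positivity) hBm hBb hB0
      (fun y => mul_nonneg (Real.exp_nonneg _) (by unfold diracLaw; split_ifs <;> simp))
      hqc hqe t ⟨hst, ht⟩ y
    exact nonneg_of_mul_nonneg_right this (Real.exp_pos _)
  · intro s t hs hst ht x
    have hsT := hst.trans ht
    simp_rw [fun y => (hu s x hsT).2 t ⟨hst, ht⟩ y]
    rw [Finset.sum_add_distrib, ← intervalIntegral.integral_finsetSum
      (fun y _ => hint s hsT t ⟨hst, ht⟩ x y)]
    -- The total mass is conserved because the rows of `G` sum to zero.
    have : ∀ r, ∑ y, ∑ z, u s x r z * G r z y = 0 := fun r => by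
      rw [Finset.sum_comm]
      simp_rw [← Finset.mul_sum, hG.sum_eq_zero, mul_zero, Finset.sum_const_zero]
    simp_rw [this]
    simp [diracLaw]
  · intro s hs hsT x y
    have := (hu s x hsT).2 s ⟨le_rfl, hsT⟩ y
    rw [this]
    simp [diracLaw, eq_comm]
  · intro s r t hs hsr hrt ht x y
    have hrT := hrt.trans ht
    have hsT := hsr.trans hrT
    -- As functions of the final time, both sides of Chapman–Kolmogorov solve the same linear
    -- equation from time `r` on, with the same value at `r`.
    refine linear_integral_unique (u := fun t y => u s x t y)
      (v := fun t y => ∑ z, u s x r z * u r z t y) (u₀ := fun y => u s x r y)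
      (abs_nonneg M) hG'.measurable hG'.bound (fun y => (huc s hsT x y).continuousOn)
      (fun y => (continuous_finsetSum _ fun z _ =>
        continuous_const.mul (huc r hrT z y)).continuousOn)
      (fun t ht y => ?_) (fun t ht y => ?_) t ⟨hrt, ht⟩ y
    · have hi1 := hint s hsT r ⟨hsr, hrT⟩ x y
      have hi2 := hint s hsT t ⟨hsr.trans ht.1, ht.2⟩ x y
      rw [(hu s x hsT).2 t ⟨hsr.trans ht.1, ht.2⟩ y, (hu s x hsT).2 r ⟨hsr, hrT⟩ y, add_assoc,
        intervalIntegral.integral_add_adjacent_intervals hi1 (hi1.symm.trans hi2)]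
    · simp_rw [fun z => (hu r z hrT).2 t ht y, mul_add]
      rw [Finset.sum_add_distrib]
      congr 1
      · exact sum_mul_diracLaw y _
      · simp_rw [← intervalIntegral.integral_const_mul]
        rw [← intervalIntegral.integral_finsetSum
          (fun z _ => (hint r hrT t ht z y).const_mul _)]
        refine intervalIntegral.integral_congr fun r' _ => ?_
        simp only [Finset.mul_sum, Finset.sum_mul]
        rw [Finset.sum_comm]
        exact Finset.sum_congr rfl fun _ _ => Finset.sum_congr rfl fun _ _ => by ring
  · intro s hs hsT x y
    exact (huc s hsT x y).continuousOn
  · intro s t hs hst ht x φ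
    have hsT := hst.trans ht
    simp_rw [fun y => (hu s x hsT).2 t ⟨hst, ht⟩ y, add_mul]
    rw [Finset.sum_add_distrib, sum_diracLaw_mul]
    congr 1
    simp_rw [← intervalIntegral.integral_mul_const]
    rw [← intervalIntegral.integral_finsetSum
      (fun z _ => (hint s hsT t ⟨hst, ht⟩ x z).mul_const _)]
    refine intervalIntegral.integral_congr fun r' _ => ?_
    simp only [Finset.mul_sum, Finset.sum_mul]
    rw [Finset.sum_comm]
    exact Finset.sum_congr rfl fun _ _ => Finset.sum_congr rfl fun _ _ => by ring

theorem lawAt_nonneg {L : ℝ → (S → ℝ) → S → ℝ} (hp : IsTransitionFunction T L p) {s t : ℝ}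
    (hs : 0 ≤ s) (hst : s ≤ t) (ht : t ≤ T) {ν : S → ℝ} (hν : ∀ x, 0 ≤ ν x) (y : S) :
    0 ≤ lawAt p s ν t y :=
  Finset.sum_nonneg fun x _ => mul_nonneg (hν x) (hp.nonneg s t hs hst ht x y)

/-- Dynkin's formula for the expected cost. -/
theorem IsRateMatrix.expectedCost_eq (hG : IsRateMatrix M G)
    (hp : IsTransitionFunction T (fun t φ x => ∑ y, G t x y * φ y) p)
    {s : ℝ} (hs : 0 ≤ s) (hsT : s ≤ T) (ν : S → ℝ) {c : ℝ → S → ℝ}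
    (hc : ∀ y, IntervalIntegrable (fun t => c t y) volume s T) {v v' : ℝ → S → ℝ}
    (hv : ∀ t ∈ Icc 0 T, ∀ x, HasDerivWithinAt (fun s => v s x) (v' t x) (Icc 0 T) t)
    (hv' : ∀ x, ContinuousOn (fun t => v' t x) (Icc 0 T)) :
    expectedCost p s T ν c (v T) = ∑ x, ν x * v s x +
      ∫ t in s..T, ∑ y, lawAt p s ν t y * (c t y + ∑ z, G t y z * v t z + v' t y) := by
  have hG' := hG.exists_bound
  have hsub : Icc s T ⊆ Icc 0 T := Icc_subset_Icc_left hs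
  have hpc := hp.continuousOn s hs hsT
  have hvc : ∀ y, ContinuousOn (fun t => v t y) (Icc s T) := fun y t ht =>
    ((hv t (hsub ht) y).continuousWithinAt).mono hsub
  have hlc : ∀ y, ContinuousOn (fun t => lawAt p s ν t y) (Icc s T) := fun y =>
    continuousOn_finsetSum _ fun x _ => continuousOn_const.mul (hpc x y)
  have hmat : ∀ y, IntervalIntegrable (fun r => ∑ z, lawAt p s ν r z * G r z y) volume s T :=
    fun y => intervalIntegrable_sum_mul hsT hG'.measurable hG'.bound hlc y
  have hv'i : ∀ y, IntervalIntegrable (fun t => v' t y) volume s T := fun y =>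
    ((hv' y).mono (by rwa [uIcc_of_le hsT])).intervalIntegrable
  have hlaw : ∀ t ∈ Icc s T, ∀ y, lawAt p s ν t y
      = ν y + ∫ r in s..t, ∑ z, lawAt p s ν r z * G r z y := by
    intro t ht y
    unfold lawAt
    simp_rw [fun x => hp.kernel_eq hs ht.1 ht.2 x y, mul_add]
    rw [Finset.sum_add_distrib]
    congr 1
    · exact sum_mul_diracLaw y _
    · simp_rw [← intervalIntegral.integral_const_mul]
      rw [← intervalIntegral.integral_finsetSum
        (fun x _ => (intervalIntegrable_sum_mul ht.1 hG'.measurable hG'.bound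
          (fun y => (hpc x y).mono (Icc_subset_Icc_right ht.2)) y).const_mul _)]
      refine intervalIntegral.integral_congr fun r' _ => ?_
      simp only [Finset.mul_sum, Finset.sum_mul]
      rw [Finset.sum_comm]
      exact Finset.sum_congr rfl fun _ _ => Finset.sum_congr rfl fun _ _ => by ring
  have hvFTC : ∀ y, ∀ t ∈ Icc s T, v t y = v s y + ∫ r in s..t, v' r y := by
    intro y t ht
    have hst : Icc s t ⊆ Icc s T := Icc_subset_Icc_right ht.2
    rw [intervalIntegral.integral_eq_sub_of_hasDerivAt_of_le ht.1 ((hvc y).mono hst)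
      (fun r hr => (hv r (hsub (hst (Ioo_subset_Icc_self hr))) y).hasDerivAt
        (Icc_mem_nhds (hs.trans_lt hr.1) (hr.2.trans_le ht.2)))
      ((hv'i y).mono_set (by rwa [uIcc_of_le ht.1, uIcc_of_le hsT]))]
    ring
  -- The product rule for law times `v`, coordinate by coordinate. After summation over `y`,
  -- exchanging the two sums moves the rate matrix from the law to `v`.
  have hprod : ∀ y, lawAt p s ν T y * v T y = ν y * v s y + ∫ r in s..T,
      ((∑ z, lawAt p s ν r z * G r z y) * v r y + lawAt p s ν r y * v' r y) := fun y =>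
    mul_eq_add_integral hsT (hmat y) (hv'i y) (fun t ht => hlaw t ht y) (hvFTC y)
  have hi2 : ∀ y, IntervalIntegrable (fun r => (∑ z, lawAt p s ν r z * G r z y) * v r y
      + lawAt p s ν r y * v' r y) volume s T := fun y =>
    ((hmat y).mul_continuousOn (by rw [uIcc_of_le hsT]; exact hvc y)).add
      ((hv'i y).continuousOn_mul (by rw [uIcc_of_le hsT]; exact hlc y))
  have hi1 : ∀ y, IntervalIntegrable (fun t => lawAt p s ν t y * c t y) volume s T := fun y =>
    (hc y).continuousOn_mul (by rw [uIcc_of_le hsT]; exact hlc y)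
  unfold expectedCost
  simp_rw [hprod]
  rw [Finset.sum_add_distrib, ← intervalIntegral.integral_finsetSum (fun y _ => hi2 y),
    add_left_comm, ← intervalIntegral.integral_add]
  · congr 1
    refine intervalIntegral.integral_congr fun r _ => ?_
    simp only [mul_add, Finset.sum_add_distrib, Finset.mul_sum, Finset.sum_mul]
    rw [add_assoc]
    congr 2
    rw [Finset.sum_comm]
    exact Finset.sum_congr rfl fun _ _ => Finset.sum_congr rfl fun _ _ => by ring
  · have := IntervalIntegrable.sum Finset.univ (fun y _ => hi1 y)
    exact this.congr fun r _ => by simp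
  · have := IntervalIntegrable.sum Finset.univ (fun y _ => hi2 y)
    exact this.congr fun r _ => by simp

end Chain

/-! ### Measurable selection of maximizers -/

section Selection

/-- Replace the tail of a binary sequence from index `n` on. -/
def splice (n : ℕ) (w c : ℕ → Bool) : ℕ → Bool := fun i => if i < n then w i else c i

theorem continuous_splice (n : ℕ) : Continuous fun z : (ℕ → Bool) × (ℕ → Bool) =>
    splice n z.1 z.2 := by
  refine continuous_pi fun i => ?_
  unfold splice
  split_ifs <;> fun_prop

theorem continuous_splice_right (n : ℕ) (w : ℕ → Bool) : Continuous (splice n w) :=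
  (continuous_splice n).comp (f := fun c => (w, c)) (by fun_prop)

theorem splice_zero (w c : ℕ → Bool) : splice 0 w c = c := by
  ext i
  simp [splice]

theorem continuous_iSup_of_compact {X Y : Type*} [TopologicalSpace X] [TopologicalSpace Y]
    [CompactSpace Y] {f : X → Y → ℝ} (hf : Continuous fun z : X × Y => f z.1 z.2) :
    Continuous fun x => ⨆ y, f x y := by
  have := (isCompact_univ (X := Y)).continuous_sSup (f := f) hf
  simpa only [image_univ, sSup_range] using this

theorem bddAbove_range_of_compact {Y : Type*} [TopologicalSpace Y] [CompactSpace Y] {f : Y → ℝ}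
    (hf : Continuous f) : BddAbove (range f) :=
  (isCompact_range hf).bddAbove

theorem exists_eq_iSup_of_compact {Y : Type*} [TopologicalSpace Y] [CompactSpace Y] [Nonempty Y]
    {f : Y → ℝ} (hf : Continuous f) : ∃ y, f y = ⨆ z, f z :=
  (isCompact_range hf).sSup_mem (range_nonempty f)

/-- The lexicographically largest prefix of a maximizer of `f`. -/
noncomputable def lexPrefix {Ω : Type*} (f : Ω → (ℕ → Bool) → ℝ) : ℕ → Ω → ℕ → Bool
  | 0, _ => fun _ => false
  | n + 1, t =>
    if (⨆ c, f t (splice (n + 1) (Function.update (lexPrefix f n t) n true) c)) = ⨆ c, f t c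
    then Function.update (lexPrefix f n t) n true else lexPrefix f n t

variable {Ω : Type*} {f : Ω → (ℕ → Bool) → ℝ}

theorem lexPrefix_apply_of_le {n i : ℕ} (h : n ≤ i) (t : Ω) : lexPrefix f n t i = false := by
  induction n with
  | zero => rfl
  | succ n ih =>
    have h1 := ih (by omega)
    have hne : i ≠ n := by omega
    rw [lexPrefix]
    split_ifs
    · rw [Function.update_of_ne hne, h1]
    · exact h1

theorem lexPrefix_apply_of_lt {n i : ℕ} (h : i < n) (t : Ω) :
    lexPrefix f n t i = lexPrefix f (i + 1) t i := by
  induction n with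
  | zero => omega
  | succ n ih =>
    rcases Nat.lt_succ_iff_lt_or_eq.1 h with h' | rfl
    · rw [← ih h']
      conv_lhs => rw [lexPrefix]
      split_ifs
      · rw [Function.update_of_ne (by omega)]
      · rfl
    · rfl

/-- No step of the construction loses the supremum. If bit `n` cannot be `true` without loss, then a
maximizer extending the current prefix has bit `n` equal to `false`, which is the default value of
`lexPrefix` there. -/
theorem iSup_splice_lexPrefix (hf : ∀ t, Continuous (f t)) (n : ℕ) (t : Ω) :
    ⨆ c, f t (splice n (lexPrefix f n t) c) = ⨆ c, f t c := by
  have hs : ∀ n w, Continuous fun c => f t (splice n w c) := fun n w =>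
    (hf t).comp (continuous_splice_right n w)
  have hle : ∀ n w, ⨆ c, f t (splice n w c) ≤ ⨆ c, f t c := fun n w =>
    ciSup_le fun c => le_ciSup (bddAbove_range_of_compact (hf t)) _
  induction n with
  | zero => simp only [splice_zero]
  | succ n ih =>
    rw [lexPrefix]
    split_ifs with h
    · exact h
    · obtain ⟨c, hc⟩ := exists_eq_iSup_of_compact (hs n (lexPrefix f n t))
      rw [ih] at hc
      refine le_antisymm (hle _ _) ?_
      cases hcn : c n with
      | true =>
        exfalso
        refine h (le_antisymm (hle _ _) ?_)
        rw [← hc]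
        convert! le_ciSup (bddAbove_range_of_compact (hs (n + 1) _)) c using 2
        ext i
        simp only [splice, Function.update_apply]
        grind
      | false =>
        rw [← hc]
        convert! le_ciSup (bddAbove_range_of_compact (hs (n + 1) _)) c using 2
        have := lexPrefix_apply_of_le (f := f) le_rfl t (n := n)
        ext i
        simp only [splice]
        grind

/-- Measurable selection of a maximizer of a jointly continuous function over a compact space. -/
theorem exists_measurable_argmax {Ω B : Type*} [TopologicalSpace Ω] [MeasurableSpace Ω]
    [OpensMeasurableSpace Ω] [SecondCountableTopology Ω]
    [MetricSpace B] [CompactSpace B] [Nonempty B] [MeasurableSpace B] [BorelSpace B]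
    {ψ : Ω → B → ℝ} (hψ : Continuous fun z : Ω × B => ψ z.1 z.2) :
    ∃ b : Ω → B, Measurable b ∧ ∀ t b', ψ t b' ≤ ψ t (b t) := by
  -- Every nonempty compact metric space is a continuous image of the Cantor space, so it is enough
  -- to choose binary sequences, bit by bit.
  obtain ⟨π, hπ, hsurj⟩ := exists_nat_bool_continuous_surjective_of_compact B
  set f : Ω → (ℕ → Bool) → ℝ := fun t c => ψ t (π c) with hf
  have hfc : Continuous fun z : Ω × (ℕ → Bool) => f z.1 z.2 :=
    hψ.comp (continuous_fst.prodMk (hπ.comp continuous_snd))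
  have hft : ∀ t, Continuous (f t) := fun t => hfc.comp (f := fun c => (t, c)) (by fun_prop)
  have hmeas : ∀ n, Measurable (lexPrefix f n) := by
    intro n
    induction n with
    | zero => exact measurable_const
    | succ n ih =>
      have hup : Measurable fun t => Function.update (lexPrefix f n t) n true := by
        refine measurable_pi_iff.2 fun i => ?_
        by_cases h : i = n
        · subst h
          simp
        · simp only [Function.update_of_ne h]
          exact (measurable_pi_apply i).comp ih
      have h1 : Continuous fun z : Ω × (ℕ → Bool) => ⨆ c, f z.1 (splice (n + 1) z.2 c) :=
        continuous_iSup_of_compact (f := fun (z : Ω × (ℕ → Bool)) c => f z.1 (splice (n + 1) z.2 c))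
          (hfc.comp ((continuous_fst.comp continuous_fst).prodMk
            ((continuous_splice (n + 1)).comp
              ((continuous_snd.comp continuous_fst).prodMk continuous_snd))))
      have h2 : Continuous fun t => ⨆ c, f t c := continuous_iSup_of_compact hfc
      -- The next bit is decided by comparing two suprema over a compact space, which are continuous
      -- in `t` and the prefix; the decision is therefore measurable.
      exact Measurable.ite (measurableSet_eq_fun
        (h1.measurable.comp (measurable_id.prodMk hup)) h2.measurable) hup ih
  set w : Ω → ℕ → Bool := fun t i => lexPrefix f (i + 1) t i with hw
  refine ⟨fun t => π (w t), hπ.measurable.comp (measurable_pi_iff.2 fun i =>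
    (measurable_pi_apply i).comp (hmeas (i + 1))), fun t b' => ?_⟩
  have hex : ∀ n, ∃ c, f t (splice n (lexPrefix f n t) c) = ⨆ c, f t c := fun n => by
    rw [← iSup_splice_lexPrefix hft n t]
    exact exists_eq_iSup_of_compact ((hft t).comp (continuous_splice_right n _))
  choose c hc using hex
  -- The maximizers with prefix of length `n` converge to the sequence `w t` of all chosen bits, so
  -- continuity makes `w t` a maximizer.
  have hlim : Filter.Tendsto (fun n => splice n (lexPrefix f n t) (c n)) Filter.atTop
      (nhds (w t)) := by
    rw [tendsto_pi_nhds]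
    intro i
    refine tendsto_const_nhds.congr' ?_
    filter_upwards [Filter.eventually_gt_atTop i] with n hn
    simp only [splice, if_pos hn, hw, lexPrefix_apply_of_lt hn]
  have h3 := ((hft t).tendsto (w t)).comp hlim
  have h4 : (f t ∘ fun n => splice n (lexPrefix f n t) (c n)) = fun _ => ⨆ c, f t c :=
    funext hc
  rw [h4] at h3
  have h5 := tendsto_nhds_unique h3 tendsto_const_nhds
  obtain ⟨c', rfl⟩ := hsurj b'
  change f t c' ≤ f t (w t)
  rw [h5]
  exact le_ciSup (bddAbove_range_of_compact (hft t)) c'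

end Selection

/-! ### HJB equations of controlled jump processes -/

section Jump

variable {S I B : Type*} [Fintype I]

/-- The Hamiltonian of a controlled jump process on `S`: jumps of type `e` lead from `x` to
`τ x e` and have rate `ρ t b x e`, the running cost is `c t b x`. -/
noncomputable def jumpHamiltonian (τ : S → I → S) (ρ : ℝ → B → S → I → ℝ) (c : ℝ → B → S → ℝ)
    (t : ℝ) (w : S → ℝ) (x : S) : ℝ :=
  ⨆ b, (-(∑ e, ρ t b x e * (w (τ x e) - w x)) - c t b x)

variable {τ : S → I → S} {ρ : ℝ → B → S → I → ℝ} {c : ℝ → B → S → ℝ}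
  [TopologicalSpace B]

theorem continuous_jump_integrand
    (hρ : ∀ x e, Continuous fun z : ℝ × B => ρ z.1 z.2 x e)
    (hc : ∀ x, Continuous fun z : ℝ × B => c z.1 z.2 x) (x : S) :
    Continuous fun z : (ℝ × (S → ℝ)) × B =>
      -(∑ e, ρ z.1.1 z.2 x e * (z.1.2 (τ x e) - z.1.2 x)) - c z.1.1 z.2 x := by
  have h : Continuous fun z : (ℝ × (S → ℝ)) × B => (z.1.1, z.2) := by fun_prop
  refine Continuous.sub (continuous_finsetSum _ fun e _ => Continuous.mul ?_ ?_).neg ?_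
  · exact (hρ x e).comp h
  · fun_prop
  · exact (hc x).comp h

variable [CompactSpace B]

theorem continuous_jumpHamiltonian
    (hρ : ∀ x e, Continuous fun z : ℝ × B => ρ z.1 z.2 x e)
    (hc : ∀ x, Continuous fun z : ℝ × B => c z.1 z.2 x) (x : S) :
    Continuous fun z : ℝ × (S → ℝ) => jumpHamiltonian τ ρ c z.1 z.2 x :=
  continuous_iSup_of_compact (f := fun (z : ℝ × (S → ℝ)) b =>
    -(∑ e, ρ z.1 b x e * (z.2 (τ x e) - z.2 x)) - c z.1 b x) (continuous_jump_integrand hρ hc x)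

theorem le_jumpHamiltonian
    (hρ : ∀ x e, Continuous fun z : ℝ × B => ρ z.1 z.2 x e)
    (hc : ∀ x, Continuous fun z : ℝ × B => c z.1 z.2 x) (t : ℝ) (w : S → ℝ) (x : S) (b : B) :
    -(∑ e, ρ t b x e * (w (τ x e) - w x)) - c t b x ≤ jumpHamiltonian τ ρ c t w x :=
  le_ciSup (f := fun b => -(∑ e, ρ t b x e * (w (τ x e) - w x)) - c t b x)
    (bddAbove_range_of_compact
      ((continuous_jump_integrand (τ := τ) hρ hc x).comp (f := fun b => ((t, w), b))
        (by fun_prop))) b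

theorem exists_eq_jumpHamiltonian [Nonempty B]
    (hρ : ∀ x e, Continuous fun z : ℝ × B => ρ z.1 z.2 x e)
    (hc : ∀ x, Continuous fun z : ℝ × B => c z.1 z.2 x) (t : ℝ) (w : S → ℝ) (x : S) :
    ∃ b, -(∑ e, ρ t b x e * (w (τ x e) - w x)) - c t b x = jumpHamiltonian τ ρ c t w x :=
  exists_eq_iSup_of_compact (f := fun b => -(∑ e, ρ t b x e * (w (τ x e) - w x)) - c t b x)
    ((continuous_jump_integrand (τ := τ) hρ hc x).comp (f := fun b => ((t, w), b)) (by fun_prop))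

/-- A maximizing action for `w` is used as a competitor for `w'`; the running costs cancel. With the
rates of the empirical measure this constant grows with `N`, so it serves existence only. -/
theorem jumpHamiltonian_sub_le [Fintype S] [Nonempty B]
    (hρ : ∀ x e, Continuous fun z : ℝ × B => ρ z.1 z.2 x e)
    (hc : ∀ x, Continuous fun z : ℝ × B => c z.1 z.2 x) {R : ℝ} (hR : ∀ t b x e, |ρ t b x e| ≤ R)
    (t : ℝ) (w w' : S → ℝ) (x : S) :
    jumpHamiltonian τ ρ c t w x - jumpHamiltonian τ ρ c t w' x
      ≤ Fintype.card I * (R * 2) * ‖w - w'‖ := by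
  obtain ⟨b, hb⟩ := exists_eq_jumpHamiltonian (τ := τ) hρ hc t w x
  have h := le_jumpHamiltonian (τ := τ) hρ hc t w' x b
  rw [← hb]
  refine (sub_le_sub_left h _).trans ?_
  have e : (-(∑ e, ρ t b x e * (w (τ x e) - w x)) - c t b x)
      - (-(∑ e, ρ t b x e * (w' (τ x e) - w' x)) - c t b x)
      = ∑ e, ρ t b x e * ((w - w') x - (w - w') (τ x e)) := by
    simp only [Pi.sub_apply]
    rw [sub_sub_sub_cancel_right, ← Finset.sum_neg_distrib, ← Finset.sum_neg_distrib,
      ← Finset.sum_sub_distrib]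
    exact Finset.sum_congr rfl fun e _ => by ring
  rw [e]
  refine (Finset.sum_le_sum (g := fun _ => R * 2 * ‖w - w'‖) fun e _ => ?_).trans
    (by simp [mul_assoc])
  refine (le_abs_self _).trans ?_
  rw [abs_mul, mul_assoc]
  have h1 := norm_le_pi_norm (w - w') x
  have h2 := norm_le_pi_norm (w - w') (τ x e)
  refine mul_le_mul (hR t b x e) ?_ (abs_nonneg _) ((abs_nonneg _).trans (hR t b x e))
  rw [two_mul]
  exact (abs_sub _ _).trans (add_le_add h1 h2)

theorem exists_hjb_solution [Fintype S] [Nonempty B] {T : ℝ} (hT : 0 ≤ T)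
    (hρ : ∀ x e, Continuous fun z : ℝ × B => ρ z.1 z.2 x e)
    (hc : ∀ x, Continuous fun z : ℝ × B => c z.1 z.2 x) {R : ℝ} (hR0 : 0 ≤ R)
    (hR : ∀ t b x e, |ρ t b x e| ≤ R) (h : S → ℝ) :
    ∃ v : ℝ → S → ℝ, Continuous v ∧ v T = h ∧
      ∀ t ∈ Icc 0 T, ∀ x, HasDerivAt (fun s => v s x) (jumpHamiltonian τ ρ c t (v t) x) t := by
  have hcont : ∀ u : ℝ → S → ℝ, Continuous u →
      Continuous fun r x => -jumpHamiltonian τ ρ c (T - r) (u r) x := fun u hu =>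
    continuous_pi fun x => ((continuous_jumpHamiltonian hρ hc x).comp
      ((continuous_const.sub continuous_id).prodMk hu)).neg
  obtain ⟨u, huc, hu⟩ := exists_integral_solution
    (Φ := fun r (w : S → ℝ) x => -jumpHamiltonian τ ρ c (T - r) w x)
    (K := Fintype.card I * (R * 2)) hT (by positivity)
    (fun u hu t _ => (hcont u hu).intervalIntegrable _ _) (fun t _ x y => by
      rw [pi_norm_le_iff_of_nonneg (by positivity)]
      intro i
      have h1 := jumpHamiltonian_sub_le (τ := τ) hρ hc hR (T - t) x y i
      have h2 := jumpHamiltonian_sub_le (τ := τ) hρ hc hR (T - t) y x i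
      rw [norm_sub_rev] at h2
      rw [Pi.sub_apply, Real.norm_eq_abs, abs_le]
      constructor <;> linarith) h
  -- The integral equation for `u` is known on `[0, T]` only. Its right-hand side, taken as a
  -- function of all times, is differentiable at the end points too; reversing time then gives the
  -- backward equation.
  set u' : ℝ → S → ℝ := fun t =>
    h + ∫ r in (0 : ℝ)..t, (fun x => -jumpHamiltonian τ ρ c (T - r) (u r) x) with hu'
  have hder : ∀ t, HasDerivAt u' (fun x => -jumpHamiltonian τ ρ c (T - t) (u t) x) t := fun t =>
    (intervalIntegral.integral_hasDerivAt_right ((hcont u huc).intervalIntegrable _ _)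
      ((hcont u huc).stronglyMeasurableAtFilter _ _) (hcont u huc).continuousAt).const_add h
  have huu : ∀ t ∈ Icc 0 T, u' t = u t := fun t ht => (hu t ht).symm
  refine ⟨fun t => u' (T - t), (continuous_iff_continuousAt.2 fun t =>
    (hder t).continuousAt).comp (by fun_prop), by simp [hu'], fun t ht x => ?_⟩
  have h1 := (hasDerivAt_pi.1 (hder (T - t)) x).comp t ((hasDerivAt_id t).const_sub T)
  rw [← huu (T - t) ⟨by linarith [ht.2], by linarith [ht.1]⟩, sub_sub_cancel] at h1
  simpa [Function.comp_def] using h1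

/-- At a spatial maximum of `v - w` every increment of `v` is at most that of `w`. With nonnegative
rates, the action that is optimal for `w` shows that the Hamiltonian of `v` is at least that of `w`,
and the maximum principle applies. -/
theorem hjb_solution_le [Finite S] [Nonempty B] {T : ℝ}
    (hρ : ∀ x e, Continuous fun z : ℝ × B => ρ z.1 z.2 x e)
    (hc : ∀ x, Continuous fun z : ℝ × B => c z.1 z.2 x)
    (hρ0 : ∀ t b x e, 0 ≤ ρ t b x e) {v w : ℝ → S → ℝ} (hT : ∀ x, v T x ≤ w T x)
    (hv : ∀ t ∈ Icc 0 T, ∀ x, HasDerivWithinAt (fun s => v s x)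
      (jumpHamiltonian τ ρ c t (v t) x) (Icc 0 T) t)
    (hw : ∀ t ∈ Icc 0 T, ∀ x, HasDerivWithinAt (fun s => w s x)
      (jumpHamiltonian τ ρ c t (w t) x) (Icc 0 T) t) :
    ∀ t ∈ Icc 0 T, ∀ x, v t x ≤ w t x := by
  intro t ht x
  refine sub_nonpos.1 (nonpos_of_deriv_nonneg_at_max (w := fun t x => v t x - w t x)
    (fun t ht x => (hv t ht x).sub (hw t ht x)) (fun t ht x hmax => ?_)
    (fun x => sub_nonpos.2 (hT x)) t ht x)
  obtain ⟨b, hb⟩ := exists_eq_jumpHamiltonian (τ := τ) hρ hc t (w t) x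
  have h := le_jumpHamiltonian (τ := τ) hρ hc t (v t) x b
  have h1 : ∑ e, ρ t b x e * (v t (τ x e) - v t x)
      ≤ ∑ e, ρ t b x e * (w t (τ x e) - w t x) :=
    Finset.sum_le_sum fun e _ => mul_le_mul_of_nonneg_left
      (by linarith [hmax (τ x e)]) (hρ0 t b x e)
  linarith

end Jump

/-! ### The grid simplex and empirical measures -/

section Grid

variable {d N : ℕ}

theorem gridSimplex_subset {m : StateVec d} (hm : m ∈ gridSimplex d N) : m ∈ simplex d := hm.1

theorem shift_self (m : StateVec d) (i : Fin d) : shift N m i i = m := by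
  simp [shift]

theorem shift_apply (m : StateVec d) (i j l : Fin d) :
    shift N m i j l = m l + 1 / N * ((if l = j then 1 else 0) - if l = i then 1 else 0) := by
  simp [shift]

theorem shift_mem_gridSimplex (hN : 0 < N) {m : StateVec d} (hm : m ∈ gridSimplex d N)
    {i : Fin d} (hi : m i ≠ 0) (j : Fin d) : shift N m i j ∈ gridSimplex d N := by
  by_cases hij : i = j
  · rw [← hij, shift_self]
    exact hm
  obtain ⟨⟨h0, h1⟩, k, hk⟩ := hm
  have hN' : (N : ℝ) ≠ 0 := by positivity
  -- A grid point with nonzero `i`-th weight has at least one agent in state `i`, so the natural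
  -- subtraction `k i - 1` below is genuine.
  have hki : 1 ≤ k i := by
    by_contra h
    have : k i = 0 := by omega
    exact hi (by simp [hk, this])
  have hcoord : ∀ l, shift N m i j l
      = ((if l = j then k l + 1 else if l = i then k l - 1 else k l : ℕ) : ℝ) / N := by
    intro l
    rw [shift_apply, hk l]
    by_cases hlj : l = j
    · have hli : l ≠ i := fun h => hij (h.symm.trans hlj)
      simp [hlj, Ne.symm hij]
      field_simp
    · by_cases hli : l = i
      · subst hli
        simp [hlj, Nat.cast_sub hki]
        field_simp
        ring
      · simp [hlj, hli]
  refine ⟨⟨fun l => ?_, ?_⟩, _, hcoord⟩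
  · rw [hcoord l]
    positivity
  · simp_rw [shift_apply]
    rw [Finset.sum_add_distrib, ← Finset.mul_sum, Finset.sum_sub_distrib]
    simp [h1]

theorem norm_shift_sub_le (m : StateVec d) (i j : Fin d) : ‖shift N m i j - m‖ ≤ 2 / N := by
  have : shift N m i j - m = (1 / (N : ℝ)) •
      (EuclideanSpace.single j (1 : ℝ) - EuclideanSpace.single i (1 : ℝ)) := by
    simp [shift]
  rw [this, norm_smul]
  have h : ‖EuclideanSpace.single j (1 : ℝ) - EuclideanSpace.single i (1 : ℝ)‖ ≤ 2 := by
    refine (norm_sub_le _ _).trans ?_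
    simp
    norm_num
  calc ‖1 / (N : ℝ)‖ * _ ≤ ‖1 / (N : ℝ)‖ * 2 := mul_le_mul_of_nonneg_left h (norm_nonneg _)
    _ = 2 / N := by
      rw [Real.norm_of_nonneg (by positivity)]
      ring

theorem shift_sub_shift (m p : StateVec d) (i j : Fin d) :
    shift N m i j - shift N p i j = m - p := by
  simp [shift]

/-- The grid point reached from `m` when an agent moves from `e.1` to `e.2`, and `m` itself if this
move is impossible. -/
noncomputable def gridMove (m : gridSimplex d N) (e : Fin d × Fin d) : gridSimplex d N :=
  open Classical in
  if h : shift N m.1 e.1 e.2 ∈ gridSimplex d N then ⟨shift N m.1 e.1 e.2, h⟩ else m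

theorem coe_gridMove (hN : 0 < N) (m : gridSimplex d N) (e : Fin d × Fin d) (hi : m.1 e.1 ≠ 0) :
    (gridMove m e).1 = shift N m.1 e.1 e.2 := by
  rw [gridMove, dif_pos (shift_mem_gridSimplex hN m.2 hi e.2)]

theorem norm_gridMove_sub_le (m : gridSimplex d N) (e : Fin d × Fin d) :
    ‖(gridMove m e).1 - m.1‖ ≤ 2 / N := by
  unfold gridMove
  split_ifs
  · exact norm_shift_sub_le _ _ _
  · simp
    positivity

theorem empirical_apply (x : Fin N → Fin d) (i : Fin d) :
    empirical x i = 1 / (N : ℝ) * ∑ k, if x k = i then (1 : ℝ) else 0 := rfl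

theorem sum_empirical_mul (x : Fin N → Fin d) (φ : Fin d → ℝ) :
    ∑ i, empirical x i * φ i = 1 / (N : ℝ) * ∑ k, φ (x k) := by
  simp_rw [empirical_apply, mul_assoc, Finset.sum_mul]
  rw [← Finset.mul_sum, Finset.sum_comm]
  simp

theorem empirical_mem (hN : 0 < N) (x : Fin N → Fin d) : empirical x ∈ gridSimplex d N := by
  refine ⟨⟨fun i => ?_, ?_⟩, fun i => (Finset.univ.filter fun k => x k = i).card, fun i => ?_⟩
  · rw [empirical_apply]
    exact mul_nonneg (by positivity) (Finset.sum_nonneg fun k _ => by split_ifs <;> simp)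
  · have := sum_empirical_mul x fun _ => 1
    simp only [mul_one] at this
    rw [this]
    have : (N : ℝ) ≠ 0 := by positivity
    simp [this]
  · rw [empirical_apply, Finset.sum_boole]
    ring

theorem empirical_apply_self_pos (hN : 0 < N) (x : Fin N → Fin d) (k : Fin N) :
    0 < empirical x (x k) := by
  rw [empirical_apply]
  refine mul_pos (by positivity) (Finset.sum_pos' (fun k _ => by split_ifs <;> simp)
    ⟨k, Finset.mem_univ _, by simp⟩)

/-- This ties the two control problems together: a function of the empirical measure sees the jump
of an agent as a grid shift. -/
theorem empirical_update (x : Fin N → Fin d) (k : Fin N) (j : Fin d) :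
    empirical (Function.update x k j) = shift N (empirical x) (x k) j := by
  ext l
  rw [shift_apply, empirical_apply, empirical_apply, ← mul_add]
  congr 1
  rw [← Finset.add_sum_erase _ _ (Finset.mem_univ k),
    ← Finset.add_sum_erase (f := fun k => if x k = l then (1 : ℝ) else 0) _ (Finset.mem_univ k)]
  have : ∀ k' ∈ Finset.univ.erase k, (if Function.update x k j k' = l then (1 : ℝ) else 0)
      = if x k' = l then 1 else 0 := fun k' hk' => by
    rw [Function.update_of_ne (Finset.ne_of_mem_erase hk')]
  rw [Finset.sum_congr rfl this, Function.update_self]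
  simp only [eq_comm (a := l)]
  ring

theorem iidLaw_nonneg {m₀ : StateVec d} (hm₀ : m₀ ∈ simplex d) (x : Fin N → Fin d) :
    0 ≤ iidLaw N m₀ x :=
  Finset.prod_nonneg fun _ _ => hm₀.1 _

/-- Change of variables: `empiricalLaw ν` is the image of `ν` under `empirical`. -/
theorem sum_empiricalLaw_mul (hN : 0 < N) (ν : (Fin N → Fin d) → ℝ) (φ : StateVec d → ℝ) :
    ∑ m : gridSimplex d N, empiricalLaw ν m * φ m.1 = ∑ x, ν x * φ (empirical x) := by
  classical
  simp_rw [empiricalLaw, Finset.sum_mul]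
  rw [Finset.sum_comm]
  refine Finset.sum_congr rfl fun x _ => ?_
  rw [Finset.sum_eq_single ⟨empirical x, empirical_mem hN x⟩]
  · simp
  · intro m _ hm
    rw [if_neg, zero_mul]
    exact fun h => hm (Subtype.ext h.symm)
  · simp

theorem isCompact_simplex (d : ℕ) : IsCompact (simplex d) := by
  refine Metric.isCompact_of_isClosed_isBounded ?_ ?_
  · have : simplex d = (⋂ i, {m : StateVec d | 0 ≤ m i}) ∩ {m | ∑ i, m i = 1} := by
      ext m
      simp [simplex]
    rw [this]
    exact (isClosed_iInter fun i => isClosed_le (by fun_prop) (by fun_prop)).inter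
      (isClosed_eq (by fun_prop) (by fun_prop))
  · refine (Metric.isBounded_iff_subset_closedBall 0).2 ⟨1, fun m hm => ?_⟩
    rw [mem_closedBall_zero_iff, EuclideanSpace.norm_eq, Real.sqrt_le_one]
    rw [← hm.2]
    refine Finset.sum_le_sum fun i _ => ?_
    have h1 : m i ≤ 1 := by
      rw [← hm.2]
      exact Finset.single_le_sum (f := fun j => m j) (fun j _ => hm.1 j) (Finset.mem_univ i)
    rw [Real.norm_of_nonneg (hm.1 i)]
    nlinarith [hm.1 i]

theorem simplex_apply_le_one {m : StateVec d} (hm : m ∈ simplex d) (i : Fin d) : m i ≤ 1 := by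
  rw [← hm.2]
  exact Finset.single_le_sum (f := fun j => m j) (fun j _ => hm.1 j) (Finset.mem_univ i)

end Grid

/-! ### Generators of jump chains and verification -/

section JumpChain

variable {S I : Type*} [Fintype S] [Fintype I]

/-- The rate matrix of a jump process: from `x`, a jump to `τ x e` has rate `r t x e`. -/
noncomputable def jumpMatrix (τ : S → I → S) (r : ℝ → S → I → ℝ) (t : ℝ) (x y : S) : ℝ :=
  ∑ e, r t x e * (diracLaw (τ x e) y - diracLaw x y)

theorem sum_jumpMatrix_mul (τ : S → I → S) (r : ℝ → S → I → ℝ) (t : ℝ) (x : S) (φ : S → ℝ) :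
    ∑ y, jumpMatrix τ r t x y * φ y = ∑ e, r t x e * (φ (τ x e) - φ x) := by
  simp_rw [jumpMatrix, Finset.sum_mul]
  rw [Finset.sum_comm]
  refine Finset.sum_congr rfl fun e _ => ?_
  simp_rw [mul_assoc]
  rw [← Finset.mul_sum]
  simp_rw [sub_mul]
  rw [Finset.sum_sub_distrib, sum_diracLaw_mul, sum_diracLaw_mul]

theorem isRateMatrix_jumpMatrix (τ : S → I → S) {r : ℝ → S → I → ℝ} {R : ℝ}
    (hm : ∀ x e, Measurable fun t => r t x e) (h0 : ∀ t x e, 0 ≤ r t x e)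
    (hR : ∀ t x e, |r t x e| ≤ R) : IsRateMatrix (Fintype.card I * R) (jumpMatrix τ r) where
  measurable x y := Finset.measurable_sum _ fun e _ => (hm x e).mul_const _
  bound t x y := by
    refine (Finset.abs_sum_le_sum_abs _ _).trans
      ((Finset.sum_le_sum (g := fun _ => R) fun e _ => ?_).trans (by simp))
    rw [abs_mul]
    refine (mul_le_of_le_one_right (abs_nonneg _) ?_).trans (hR t x e)
    unfold diracLaw
    split_ifs <;> simp
  nonneg t x y hxy := Finset.sum_nonneg fun e _ => mul_nonneg (h0 t x e) (by
    simp only [diracLaw, if_neg hxy.symm]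
    split_ifs <;> simp)
  sum_eq_zero t x := by
    have := sum_jumpMatrix_mul τ r t x fun _ => 1
    simpa using this

end JumpChain

section Generator

variable {S : Type*} [Fintype S]

/-- `L` is on `[0, T]` the generator of a time-inhomogeneous Markov chain with bounded measurable
rates. -/
def IsChainGenerator (T : ℝ) (L : ℝ → (S → ℝ) → S → ℝ) : Prop :=
  ∃ M G, IsRateMatrix M G ∧ ∀ t ∈ Icc 0 T, ∀ (φ : S → ℝ) x, L t φ x = ∑ y, G t x y * φ y

variable {T : ℝ} {L : ℝ → (S → ℝ) → S → ℝ}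

theorem IsChainGenerator.of_jump {I : Type*} [Fintype I] (τ : S → I → S) {r : ℝ → S → I → ℝ} {R : ℝ}
    (hm : ∀ x e, Measurable fun t => r t x e) (h0 : ∀ t x e, 0 ≤ r t x e)
    (hR : ∀ t x e, |r t x e| ≤ R)
    (hL : ∀ t ∈ Icc 0 T, ∀ (φ : S → ℝ) x, L t φ x = ∑ e, r t x e * (φ (τ x e) - φ x)) :
    IsChainGenerator T L :=
  ⟨_, _, isRateMatrix_jumpMatrix τ hm h0 hR, fun t ht φ x => by
    rw [hL t ht, sum_jumpMatrix_mul]⟩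

theorem IsChainGenerator.exists_transition (h : IsChainGenerator T L) :
    ∃ p, IsTransitionFunction T L p := by
  obtain ⟨M, G, hG, hL⟩ := h
  obtain ⟨p, hp⟩ := hG.exists_transition T
  exact ⟨p, hp.congr fun t ht φ x => (hL t ht φ x).symm⟩

theorem IsChainGenerator.transition_unique (h : IsChainGenerator T L) {p p' : ℝ → ℝ → S → S → ℝ}
    (hp : IsTransitionFunction T L p) (hp' : IsTransitionFunction T L p')
    {s t : ℝ} (hs : 0 ≤ s) (hst : s ≤ t) (ht : t ≤ T) : p s t = p' s t := by
  obtain ⟨M, G, hG, hL⟩ := h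
  exact hG.transition_unique (hp.congr hL) (hp'.congr hL) hs hst ht

variable {p : ℝ → ℝ → S → S → ℝ} {s : ℝ} {c v v' : ℝ → S → ℝ}

theorem IsChainGenerator.expectedCost_eq (h : IsChainGenerator T L)
    (hp : IsTransitionFunction T L p) (hs : 0 ≤ s) (hsT : s ≤ T) (ν : S → ℝ)
    (hc : ∀ y, IntervalIntegrable (fun t => c t y) volume s T)
    (hv : ∀ t ∈ Icc 0 T, ∀ x, HasDerivWithinAt (fun s => v s x) (v' t x) (Icc 0 T) t)
    (hv' : ∀ x, ContinuousOn (fun t => v' t x) (Icc 0 T)) :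
    expectedCost p s T ν c (v T) = ∑ x, ν x * v s x +
      ∫ t in s..T, ∑ y, lawAt p s ν t y * (c t y + L t (v t) y + v' t y) := by
  obtain ⟨M, G, hG, hL⟩ := h
  rw [hG.expectedCost_eq (hp.congr hL) hs hsT ν hc hv hv']
  congr 1
  refine intervalIntegral.integral_congr fun t ht => ?_
  rw [uIcc_of_le hsT] at ht
  simp_rw [hL t ⟨hs.trans ht.1, ht.2⟩]

/-- Verification: a subsolution bounds the expected cost from below. -/
theorem IsChainGenerator.le_expectedCost (h : IsChainGenerator T L)
    (hp : IsTransitionFunction T L p) (hs : 0 ≤ s) (hsT : s ≤ T) {ν : S → ℝ} (hν : ∀ x, 0 ≤ ν x)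
    (hc : ∀ y, IntervalIntegrable (fun t => c t y) volume s T)
    (hv : ∀ t ∈ Icc 0 T, ∀ x, HasDerivWithinAt (fun s => v s x) (v' t x) (Icc 0 T) t)
    (hv' : ∀ x, ContinuousOn (fun t => v' t x) (Icc 0 T))
    (hsub : ∀ t ∈ Icc 0 T, ∀ x, 0 ≤ c t x + L t (v t) x + v' t x) :
    ∑ x, ν x * v s x ≤ expectedCost p s T ν c (v T) := by
  rw [h.expectedCost_eq hp hs hsT ν hc hv hv']
  refine le_add_of_nonneg_right (intervalIntegral.integral_nonneg hsT fun t ht =>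
    Finset.sum_nonneg fun y _ => mul_nonneg (lawAt_nonneg hp hs ht.1 ht.2 hν y)
      (hsub t ⟨hs.trans ht.1, ht.2⟩ y))

/-- Verification: a solution is the expected cost. -/
theorem IsChainGenerator.expectedCost_eq_of_solution (h : IsChainGenerator T L)
    (hp : IsTransitionFunction T L p) (hs : 0 ≤ s) (hsT : s ≤ T) (ν : S → ℝ)
    (hc : ∀ y, IntervalIntegrable (fun t => c t y) volume s T)
    (hv : ∀ t ∈ Icc 0 T, ∀ x, HasDerivWithinAt (fun s => v s x) (v' t x) (Icc 0 T) t)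
    (hv' : ∀ x, ContinuousOn (fun t => v' t x) (Icc 0 T))
    (hsol : ∀ t ∈ Icc 0 T, ∀ x, c t x + L t (v t) x + v' t x = 0) :
    expectedCost p s T ν c (v T) = ∑ x, ν x * v s x := by
  rw [h.expectedCost_eq hp hs hsT ν hc hv hv', add_eq_left]
  refine (intervalIntegral.integral_congr (g := fun _ => (0 : ℝ)) fun t ht => ?_).trans (by simp)
  rw [uIcc_of_le hsT] at ht
  exact Finset.sum_eq_zero fun y _ => by rw [hsol t ⟨hs.trans ht.1, ht.2⟩ y, mul_zero]

end Generator

/-- The point of `[0, T]` closest to `t`. -/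
noncomputable def clampTime (T t : ℝ) : ℝ := max 0 (min t T)

theorem continuous_clampTime (T : ℝ) : Continuous (clampTime T) := by
  unfold clampTime
  fun_prop

theorem clampTime_mem {T : ℝ} (hT : 0 ≤ T) (t : ℝ) : clampTime T t ∈ Icc 0 T :=
  ⟨le_max_left _ _, max_le hT (min_le_right _ _)⟩

theorem clampTime_of_mem {T t : ℝ} (ht : t ∈ Icc 0 T) : clampTime T t = t := by
  rw [clampTime, min_eq_left ht.2, max_eq_right ht.1]

/-! ### Coefficients and Hamiltonian of the empirical measure -/

namespace ControlData

variable {d N : ℕ} {A : Type*} {D : ControlData d A}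

/-- Only `F` is assumed continuous. Changing one coordinate of the joint action isolates `m i *
f^i`, which gives access to `f^i` wherever `m i ≠ 0`. -/
theorem F_update (D : ControlData d A) (t : ℝ) (b : Fin d → A) (m : StateVec d) (i : Fin d)
    (a : A) :
    D.F t (Function.update b i a) m = D.F t b m + m i * (D.f i t a m - D.f i t (b i) m) := by
  classical
  unfold F
  rw [← Finset.add_sum_erase _ _ (Finset.mem_univ i),
    ← Finset.add_sum_erase (f := fun i => m i * D.f i t (b i) m) _ (Finset.mem_univ i)]
  have : ∀ k ∈ Finset.univ.erase i, m k * D.f k t (Function.update b i a k) m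
      = m k * D.f k t (b k) m := fun k hk => by
    rw [Function.update_of_ne (Finset.ne_of_mem_erase hk)]
  rw [Finset.sum_congr rfl this, Function.update_self]
  ring

section Continuity

variable [TopologicalSpace A]

/-- Freezing time outside `[0, T]` turns the hypotheses into statements for all real times, as the
general results on jump processes require. -/
theorem AssumptionA.continuous_Q (hA : D.AssumptionA) (hT : 0 ≤ D.T) (i j : Fin d) {m : StateVec d}
    (hm : m ∈ simplex d) : Continuous fun z : ℝ × A => D.Q i j (clampTime D.T z.1) z.2 m := by
  have hc : Continuous fun z : ℝ × A => (clampTime D.T z.1, z.2, m) :=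
    ((continuous_clampTime _).comp continuous_fst).prodMk (continuous_snd.prodMk continuous_const)
  exact (hA.Q_continuous i j).comp_continuous hc
    fun z => ⟨clampTime_mem hT _, mem_univ _, hm⟩

theorem AssumptionA.continuous_F (hA : D.AssumptionA) (hT : 0 ≤ D.T) {m : StateVec d}
    (hm : m ∈ simplex d) : Continuous fun z : ℝ × (Fin d → A) =>
      D.F (clampTime D.T z.1) z.2 m := by
  have hc : Continuous fun z : ℝ × (Fin d → A) => (clampTime D.T z.1, z.2, m) :=
    ((continuous_clampTime _).comp continuous_fst).prodMk (continuous_snd.prodMk continuous_const)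
  exact hA.F_continuous.comp_continuous hc
    fun z => ⟨clampTime_mem hT _, mem_univ _, hm⟩

theorem AssumptionA.exists_Q_bound [CompactSpace A] (hA : D.AssumptionA) :
    ∃ q, 0 ≤ q ∧ ∀ i j, ∀ t ∈ Icc 0 D.T, ∀ a, ∀ m ∈ simplex d, |D.Q i j t a m| ≤ q := by
  have h : ∀ i j, ∃ q, ∀ t ∈ Icc 0 D.T, ∀ a, ∀ m ∈ simplex d, |D.Q i j t a m| ≤ q := fun i j => by
    obtain ⟨q, hq⟩ := (isCompact_Icc.prod (isCompact_univ.prod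
      (isCompact_simplex d))).exists_bound_of_continuousOn (hA.Q_continuous i j)
    exact ⟨q, fun t ht a m hm => hq (t, a, m) ⟨ht, mem_univ _, hm⟩⟩
  choose q hq using h
  refine ⟨∑ i, ∑ j, |q i j|, by positivity, fun i j t ht a m hm =>
    (hq i j t ht a m hm).trans ((le_abs_self _).trans ?_)⟩
  exact (Finset.single_le_sum (f := fun j => |q i j|) (fun _ _ => abs_nonneg _)
    (Finset.mem_univ j)).trans (Finset.single_le_sum (f := fun i => ∑ j, |q i j|)
    (fun _ _ => Finset.sum_nonneg fun _ _ => abs_nonneg _) (Finset.mem_univ i))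

theorem AssumptionA.exists_F_bound [CompactSpace A] (hA : D.AssumptionA) :
    ∃ q, 0 ≤ q ∧ ∀ t ∈ Icc 0 D.T, ∀ a, ∀ m ∈ simplex d, |D.F t a m| ≤ q := by
  obtain ⟨q, hq⟩ := (isCompact_Icc.prod (isCompact_univ.prod
    (isCompact_simplex d))).exists_bound_of_continuousOn hA.F_continuous
  exact ⟨|q|, abs_nonneg _, fun t ht a m hm =>
    (hq (t, a, m) ⟨ht, mem_univ _, hm⟩).trans (le_abs_self _)⟩

theorem AssumptionA.continuous_f [Nonempty A] (hA : D.AssumptionA) {t : ℝ} (ht : t ∈ Icc 0 D.T)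
    {m : StateVec d} (hm : m ∈ simplex d) {i : Fin d} (hi : m i ≠ 0) :
    Continuous fun a => D.f i t a m := by
  obtain ⟨a₀⟩ := ‹Nonempty A›
  have h : ∀ a, D.f i t a m = (m i)⁻¹ * (D.F (clampTime D.T t) (Function.update (fun _ => a₀) i a) m
      - D.F (clampTime D.T t) (fun _ => a₀) m) + D.f i t a₀ m := fun a => by
    rw [clampTime_of_mem ht, F_update]
    field_simp
    ring
  rw [funext h]
  have hF : Continuous fun a => D.F (clampTime D.T t) (Function.update (fun _ => a₀) i a) m :=
    (hA.continuous_F (ht.1.trans ht.2) hm).comp (f := fun a => (t, Function.update (fun _ => a₀) i a))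
      (continuous_const.prodMk (continuous_const.update i continuous_id))
  exact (continuous_const.mul (hF.sub continuous_const)).add continuous_const

theorem AssumptionA.continuous_hamiltonian_integrand [Nonempty A] (hA : D.AssumptionA) {t : ℝ}
    (ht : t ∈ Icc 0 D.T) {m : StateVec d} (hm : m ∈ simplex d) {i : Fin d} (hi : m i ≠ 0)
    (z : Fin d → ℝ) : Continuous fun a => -(∑ j, D.Q i j t a m * z j) - D.f i t a m := by
  refine (continuous_finsetSum _ fun j _ => ?_).neg.sub (hA.continuous_f ht hm hi)
  refine Continuous.mul ?_ continuous_const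
  have h := (hA.continuous_Q (ht.1.trans ht.2) i j hm).comp (f := fun a : A => (t, a)) (by fun_prop)
  simpa [Function.comp_def, clampTime_of_mem ht] using h

theorem AssumptionA.le_hamiltonian [CompactSpace A] [Nonempty A] (hA : D.AssumptionA) {t : ℝ}
    (ht : t ∈ Icc 0 D.T) {m : StateVec d} (hm : m ∈ simplex d) {i : Fin d} (hi : m i ≠ 0)
    (z : Fin d → ℝ) (a : A) :
    -(∑ j, D.Q i j t a m * z j) - D.f i t a m ≤ D.hamiltonian i t m z :=
  le_ciSup (bddAbove_range_of_compact (hA.continuous_hamiltonian_integrand ht hm hi z)) a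

/-- The weight `m i` removes the states with `m i = 0`, where the supremum in the Hamiltonian may
fail to be finite and its formal value carries no information. -/
theorem AssumptionA.mul_le_mul_hamiltonian [CompactSpace A] [Nonempty A] (hA : D.AssumptionA)
    {t : ℝ} (ht : t ∈ Icc 0 D.T) {m : StateVec d} (hm : m ∈ simplex d) (i : Fin d)
    (z : Fin d → ℝ) (a : A) :
    m i * (-(∑ j, D.Q i j t a m * z j) - D.f i t a m) ≤ m i * D.hamiltonian i t m z := by
  rcases eq_or_ne (m i) 0 with h | h
  · simp [h]
  · exact mul_le_mul_of_nonneg_left (hA.le_hamiltonian ht hm h z a) (hm.1 i)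

theorem AssumptionA.exists_mul_eq_mul_hamiltonian [CompactSpace A] [Nonempty A]
    (hA : D.AssumptionA) {t : ℝ} (ht : t ∈ Icc 0 D.T) {m : StateVec d} (hm : m ∈ simplex d)
    (i : Fin d) (z : Fin d → ℝ) :
    ∃ a, m i * (-(∑ j, D.Q i j t a m * z j) - D.f i t a m) = m i * D.hamiltonian i t m z := by
  rcases eq_or_ne (m i) 0 with h | h
  · exact ⟨Classical.arbitrary A, by simp [h]⟩
  · obtain ⟨a, ha⟩ := exists_eq_iSup_of_compact (hA.continuous_hamiltonian_integrand ht hm h z)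
    exact ⟨a, by rw [ha]; rfl⟩

end Continuity

section EmpiricalRates

/-- The jump rates of the empirical measure when all agents in state `i` use the action `b i`. -/
noncomputable def empRate (D : ControlData d A) (N : ℕ) (t : ℝ) (b : Fin d → A) (m : gridSimplex d N)
    (e : Fin d × Fin d) : ℝ :=
  N * (m.1 e.1 * D.Q e.1 e.2 (clampTime D.T t) (b e.1) m.1)

/-- The running cost of the empirical measure when all agents in state `i` use the action `b i`. -/
noncomputable def empCost (D : ControlData d A) (N : ℕ) (t : ℝ) (b : Fin d → A) (m : gridSimplex d N) : ℝ :=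
  D.F (clampTime D.T t) b m.1

/-- `gridMove` and `shift` can differ only where `m i = 0`, and there the rate vanishes. -/
theorem sum_empRate_mul (hN : 0 < N) (t : ℝ) (b : Fin d → A) (m : gridSimplex d N)
    (V : StateVec d → ℝ) :
    ∑ e, D.empRate N t b m e * (V (gridMove m e).1 - V m.1)
      = ∑ i, m.1 i * ∑ j, D.Q i j (clampTime D.T t) (b i) m.1 * discreteDeriv N i V m.1 j := by
  rw [Fintype.sum_prod_type]
  refine Finset.sum_congr rfl fun i _ => ?_
  rw [Finset.mul_sum]
  refine Finset.sum_congr rfl fun j _ => ?_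
  rcases eq_or_ne (m.1 i) 0 with h | h
  · simp [empRate, h]
  · rw [coe_gridMove hN m (i, j) h, empRate, discreteDeriv]
    ring

theorem empGenerator_eq_sum_empRate (hN : 0 < N) (α : ℝ → Fin d → StateVec d → A) {t : ℝ}
    (ht : t ∈ Icc 0 D.T) (φ : gridSimplex d N → ℝ) (m : gridSimplex d N) :
    D.empGenerator N α t φ m
      = ∑ e, D.empRate N t (fun i => α t i m.1) m e * (φ (gridMove m e) - φ m) := by
  rw [empGenerator, Fintype.sum_prod_type, Finset.mul_sum]
  refine Finset.sum_congr rfl fun i _ => ?_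
  rw [Finset.mul_sum]
  refine Finset.sum_congr rfl fun j _ => ?_
  rcases eq_or_ne (m.1 i) 0 with h | h
  · simp [empRate, h]
  · have hs := shift_mem_gridSimplex hN m.2 h j
    rw [dif_pos hs, empRate, gridMove, dif_pos hs, clampTime_of_mem ht]
    ring

theorem empRate_bound (hT : 0 ≤ D.T) {q : ℝ}
    (hq : ∀ i j, ∀ t ∈ Icc 0 D.T, ∀ a, ∀ m ∈ simplex d, |D.Q i j t a m| ≤ q) (t : ℝ)
    (b : Fin d → A) (m : gridSimplex d N) (e : Fin d × Fin d) : |D.empRate N t b m e| ≤ N * q := by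
  rw [empRate, abs_mul, Nat.abs_cast, abs_mul, abs_of_nonneg (m.2.1.1 _)]
  refine mul_le_mul_of_nonneg_left ?_ (Nat.cast_nonneg _)
  exact (mul_le_of_le_one_left (abs_nonneg _) (simplex_apply_le_one m.2.1 _)).trans
    (hq _ _ _ (clampTime_mem hT t) _ _ m.2.1)

theorem empIntegrand_eq (hN : 0 < N) {t : ℝ} (ht : t ∈ Icc 0 D.T) (b : Fin d → A)
    (m : gridSimplex d N) (V : StateVec d → ℝ) :
    -(∑ e, D.empRate N t b m e * (V (gridMove m e).1 - V m.1)) - D.empCost N t b m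
      = ∑ i, m.1 i * (-(∑ j, D.Q i j t (b i) m.1 * discreteDeriv N i V m.1 j)
        - D.f i t (b i) m.1) := by
  rw [sum_empRate_mul hN, empCost, F, clampTime_of_mem ht, ← Finset.sum_neg_distrib,
    ← Finset.sum_sub_distrib]
  exact Finset.sum_congr rfl fun i _ => by ring

variable [TopologicalSpace A]

theorem AssumptionA.empRate_nonneg (hA : D.AssumptionA) (hT : 0 ≤ D.T) (t : ℝ) (b : Fin d → A)
    (m : gridSimplex d N) (e : Fin d × Fin d) : 0 ≤ D.empRate N t b m e :=
  mul_nonneg (Nat.cast_nonneg _) (mul_nonneg (m.2.1.1 _)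
    (hA.Q_nonneg _ _ _ (clampTime_mem hT t) _ _ m.2.1))

theorem AssumptionA.continuous_empRate (hA : D.AssumptionA) (hT : 0 ≤ D.T) (m : gridSimplex d N)
    (e : Fin d × Fin d) : Continuous fun z : ℝ × (Fin d → A) => D.empRate N z.1 z.2 m e :=
  continuous_const.mul (continuous_const.mul ((hA.continuous_Q hT e.1 e.2 m.2.1).comp
    (f := fun z : ℝ × (Fin d → A) => (z.1, z.2 e.1)) (by fun_prop)))

theorem AssumptionA.continuous_empCost (hA : D.AssumptionA) (hT : 0 ≤ D.T) (m : gridSimplex d N) :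
    Continuous fun z : ℝ × (Fin d → A) => D.empCost N z.1 z.2 m :=
  hA.continuous_F hT m.2.1

/-- The Hamiltonian of the empirical measure process, a maximum over `A^d`. -/
theorem AssumptionA.jumpHamiltonian_eq [CompactSpace A] [Nonempty A] (hA : D.AssumptionA)
    (hN : 0 < N) {t : ℝ} (ht : t ∈ Icc 0 D.T) (m : gridSimplex d N) (V : StateVec d → ℝ) :
    jumpHamiltonian gridMove (D.empRate N) (D.empCost N) t (fun m => V m.1) m
      = ∑ i, m.1 i * D.hamiltonian i t m.1 (discreteDeriv N i V m.1) := by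
  have hT := ht.1.trans ht.2
  refine le_antisymm ?_ ?_
  · refine ciSup_le fun b => ?_
    rw [empIntegrand_eq hN ht]
    exact Finset.sum_le_sum fun i _ => hA.mul_le_mul_hamiltonian ht m.2.1 i _ _
  · choose b hb using fun i => hA.exists_mul_eq_mul_hamiltonian ht m.2.1 i
      (discreteDeriv N i V m.1)
    have h := le_jumpHamiltonian (τ := gridMove) (hA.continuous_empRate hT (N := N))
      (hA.continuous_empCost hT) t (fun m => V m.1) m b
    rw [empIntegrand_eq hN ht, Finset.sum_congr rfl fun i _ => hb i] at h
    exact h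

end EmpiricalRates

end ControlData

/-! ### Lipschitz estimates uniform in the number of agents -/

/-- A coupling estimate: jumps of both points at the common rate `min a b` contribute a nonpositive
amount since `δ₂ ≤ δ₁`, and the excess rate `|a - b|` belongs to one point jumping alone, at the
price `K * r`. -/
theorem jump_difference_le {a b K δ₁ δ₂ r : ℝ} (ha : 0 ≤ a) (hb : 0 ≤ b)
    (h12 : 0 < a → 0 < b → δ₂ ≤ δ₁) (h1 : -δ₁ ≤ K * r) (h2 : δ₂ ≤ K * r) :
    b * δ₂ - a * δ₁ ≤ |a - b| * (K * r) := by
  rcases le_total b a with h | h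
  · rw [abs_of_nonneg (sub_nonneg.2 h)]
    have h3 : b * (δ₂ - δ₁) ≤ 0 := by
      rcases hb.eq_or_lt with h0 | h0
      · simp [← h0]
      · exact mul_nonpos_of_nonneg_of_nonpos hb (sub_nonpos.2 (h12 (h0.trans_le h) h0))
    have h4 := mul_le_mul_of_nonneg_left h1 (sub_nonneg.2 h)
    linarith
  · rw [abs_of_nonpos (sub_nonpos.2 h)]
    have h3 : a * (δ₂ - δ₁) ≤ 0 := by
      rcases ha.eq_or_lt with h0 | h0
      · simp [← h0]
      · exact mul_nonpos_of_nonneg_of_nonpos ha (sub_nonpos.2 (h12 h0 (h0.trans_le h)))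
    have h4 := mul_le_mul_of_nonneg_left h2 (sub_nonneg.2 h)
    linarith

namespace ControlData

variable {d N : ℕ} {A : Type*} {D : ControlData d A}

theorem abs_empRate_sub_le (hT : 0 ≤ D.T) {q C : ℝ}
    (hq : ∀ i j, ∀ t ∈ Icc 0 D.T, ∀ a, ∀ m ∈ simplex d, |D.Q i j t a m| ≤ q)
    (hC : ∀ i j, ∀ t ∈ Icc 0 D.T, ∀ a, ∀ m ∈ simplex d, ∀ p ∈ simplex d,
      |D.Q i j t a m - D.Q i j t a p| ≤ C * ‖m - p‖) (t : ℝ) (b : Fin d → A)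
    (m p : gridSimplex d N) (e : Fin d × Fin d) :
    |D.empRate N t b m e - D.empRate N t b p e| ≤ N * ((q + C) * ‖p.1 - m.1‖) := by
  have ht := clampTime_mem hT t
  rw [empRate, empRate, ← mul_sub, abs_mul, Nat.abs_cast, norm_sub_rev]
  refine mul_le_mul_of_nonneg_left ?_ (Nat.cast_nonneg _)
  have h1 := hq e.1 e.2 _ ht (b e.1) m.1 m.2.1
  have h2 := hC e.1 e.2 _ ht (b e.1) m.1 m.2.1 p.1 p.2.1
  have h3 : |m.1 e.1 - p.1 e.1| ≤ ‖m.1 - p.1‖ := PiLp.norm_apply_le (m.1 - p.1) e.1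
  set x := D.Q e.1 e.2 (clampTime D.T t) (b e.1) m.1
  set y := D.Q e.1 e.2 (clampTime D.T t) (b e.1) p.1
  have e1 : m.1 e.1 * x - p.1 e.1 * y = (m.1 e.1 - p.1 e.1) * x + p.1 e.1 * (x - y) := by ring
  rw [e1]
  refine (abs_add_le _ _).trans ?_
  rw [abs_mul, abs_mul, abs_of_nonneg (p.2.1.1 e.1)]
  have h4 := mul_le_mul h3 h1 (abs_nonneg _) (norm_nonneg _)
  have h5 := (mul_le_of_le_one_left (abs_nonneg (x - y)) (simplex_apply_le_one p.2.1 e.1)).trans h2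
  linarith

variable [TopologicalSpace A] [CompactSpace A] [Nonempty A]

/-- Doubling of variables. The slope `K t` equals `CG` at the final time and solves `K' = -CF * exp
(C₁ * (T - t)) - C₁ * K`; its decrease pays for the variation of the running cost and of the rates.
-/
theorem AssumptionA.hjb_sub_le (hA : D.AssumptionA) (hT : 0 ≤ D.T) (hN : 0 < N) {q C CF CG : ℝ}
    (hq0 : 0 ≤ q) (hC0 : 0 ≤ C) (hCF0 : 0 ≤ CF) (hCG0 : 0 ≤ CG)
    (hq : ∀ i j, ∀ t ∈ Icc 0 D.T, ∀ a, ∀ m ∈ simplex d, |D.Q i j t a m| ≤ q)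
    (hC : ∀ i j, ∀ t ∈ Icc 0 D.T, ∀ a, ∀ m ∈ simplex d, ∀ p ∈ simplex d,
      |D.Q i j t a m - D.Q i j t a p| ≤ C * ‖m - p‖)
    (hCF : ∀ t ∈ Icc 0 D.T, ∀ a, ∀ m ∈ simplex d, ∀ p ∈ simplex d,
      |D.F t a m - D.F t a p| ≤ CF * ‖m - p‖)
    (hCG : ∀ m ∈ simplex d, ∀ p ∈ simplex d, |D.G m - D.G p| ≤ CG * ‖m - p‖)
    {v : ℝ → gridSimplex d N → ℝ} (hvT : ∀ m, v D.T m = D.G m.1)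
    (hv : ∀ t ∈ Icc 0 D.T, ∀ m, HasDerivWithinAt (fun s => v s m)
      (jumpHamiltonian gridMove (D.empRate N) (D.empCost N) t (v t) m) (Icc 0 D.T) t) :
    ∀ t ∈ Icc 0 D.T, ∀ m p, v t p - v t m ≤
      (CG + CF * (D.T - t)) * Real.exp (2 * d ^ 2 * (q + C) * (D.T - t)) * ‖p.1 - m.1‖ := by
  -- There are `d ^ 2` types of jumps, `N * (q + C)` is the Lipschitz constant of each rate, and a
  -- jump has length at most `2 / N`.
  set C₁ : ℝ := 2 * d ^ 2 * (q + C) with hC₁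
  set K : ℝ → ℝ := fun t => (CG + CF * (D.T - t)) * Real.exp (C₁ * (D.T - t)) with hK
  have hKd : ∀ t, HasDerivAt K (-CF * Real.exp (C₁ * (D.T - t)) - C₁ * K t) t := by
    intro t
    have h1 : HasDerivAt (fun t => D.T - t) (-1) t := by
      simpa using (hasDerivAt_id t).const_sub D.T
    have h2 := ((h1.const_mul CF).const_add CG).mul (h1.const_mul C₁).exp
    convert! h2 using 1
    simp only [hK]
    ring
  intro t ht m p
  refine sub_nonpos.1 (nonpos_of_deriv_nonneg_at_max (S := gridSimplex d N × gridSimplex d N)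
    (w := fun t z => v t z.2 - v t z.1 - K t * ‖z.2.1 - z.1.1‖)
    (fun t ht z => ((hv t ht z.2).sub (hv t ht z.1)).sub
      ((hKd t).hasDerivWithinAt.mul_const _)) ?_ ?_ t ht (m, p))
  · rintro t ht ⟨m, p⟩ hmax
    dsimp only at hmax ⊢
    have hTt : 0 ≤ D.T - t := sub_nonneg.2 ht.2
    have hC₁0 : 0 ≤ C₁ := by positivity
    have hK0 : 0 ≤ K t := by positivity
    -- The action optimal at `m` is used at `p` as well, so that rates and costs are compared under
    -- the same action.
    obtain ⟨b, hb⟩ := exists_eq_jumpHamiltonian (τ := gridMove) (hA.continuous_empRate hT (N := N))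
      (hA.continuous_empCost hT) t (v t) m
    have hle := le_jumpHamiltonian (τ := gridMove) (hA.continuous_empRate hT (N := N))
      (hA.continuous_empCost hT) t (v t) p b
    rw [← hb]
    have hcost : D.empCost N t b p - D.empCost N t b m ≤ CF * ‖p.1 - m.1‖ :=
      (le_abs_self _).trans (hCF _ (clampTime_mem hT t) b p.1 p.2.1 m.1 m.2.1)
    have hjump : ∀ e, D.empRate N t b p e * (v t (gridMove p e) - v t p)
        - D.empRate N t b m e * (v t (gridMove m e) - v t m)
        ≤ 2 * (q + C) * K t * ‖p.1 - m.1‖ := by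
      intro e
      -- Maximality is tested by moving `m` alone, `p` alone, and both together. The joint move
      -- compares the two increments without loss when both rates are positive, since then `p - m`
      -- does not change.
      have hm1 := hmax (gridMove m e, p)
      have hm2 := hmax (m, gridMove p e)
      have hm3 := hmax (gridMove m e, gridMove p e)
      dsimp only at hm1 hm2 hm3
      have hn1 : ‖p.1 - (gridMove m e).1‖ ≤ ‖p.1 - m.1‖ + 2 / N := by
        have := norm_sub_le (p.1 - m.1) ((gridMove m e).1 - m.1)
        rw [sub_sub_sub_cancel_right] at this
        linarith [norm_gridMove_sub_le m e]
      have hn2 : ‖(gridMove p e).1 - m.1‖ ≤ ‖p.1 - m.1‖ + 2 / N := by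
        have := norm_add_le ((gridMove p e).1 - p.1) (p.1 - m.1)
        rw [sub_add_sub_cancel] at this
        linarith [norm_gridMove_sub_le p e]
      refine (jump_difference_le (K := K t) (r := 2 / N) (hA.empRate_nonneg hT t b m e)
        (hA.empRate_nonneg hT t b p e) ?_ ?_ ?_).trans ?_
      · intro h1 h2
        have hmi : m.1 e.1 ≠ 0 := fun h => by simp [empRate, h] at h1
        have hpi : p.1 e.1 ≠ 0 := fun h => by simp [empRate, h] at h2
        rw [coe_gridMove hN m e hmi, coe_gridMove hN p e hpi, shift_sub_shift] at hm3
        linarith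
      · linarith [mul_le_mul_of_nonneg_left hn1 hK0]
      · linarith [mul_le_mul_of_nonneg_left hn2 hK0]
      · refine (mul_le_mul_of_nonneg_right (abs_empRate_sub_le hT hq hC t b m p e)
          (by positivity)).trans (le_of_eq ?_)
        have : (N : ℝ) ≠ 0 := by positivity
        field_simp
    have hsum : ∑ e, D.empRate N t b p e * (v t (gridMove p e) - v t p)
        - ∑ e, D.empRate N t b m e * (v t (gridMove m e) - v t m)
        ≤ C₁ * K t * ‖p.1 - m.1‖ := by
      rw [← Finset.sum_sub_distrib]
      refine (Finset.sum_le_sum fun e _ => hjump e).trans (le_of_eq ?_)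
      simp [hC₁]
      ring
    have hexp : CF ≤ CF * Real.exp (C₁ * (D.T - t)) :=
      le_mul_of_one_le_right hCF0 (Real.one_le_exp (by positivity))
    have hfin := mul_le_mul_of_nonneg_right hexp (norm_nonneg (p.1 - m.1))
    linarith
  · rintro ⟨m, p⟩
    have := (le_abs_self _).trans (hCG p.1 p.2.1 m.1 m.2.1)
    simp only [hvT, hK, sub_self, mul_zero, add_zero, Real.exp_zero, mul_one]
    linarith

/-- Solutions of the HJB system are Lipschitz continuous, uniformly in the number of agents. -/
theorem AssumptionA.exists_hjb_lipschitz (hA : D.AssumptionA) (hT : 0 ≤ D.T) :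
    ∃ C : ℝ, ∀ N : ℕ, 0 < N → ∀ v : ℝ → gridSimplex d N → ℝ, (∀ m, v D.T m = D.G m.1) →
      (∀ t ∈ Icc 0 D.T, ∀ m, HasDerivWithinAt (fun s => v s m)
        (jumpHamiltonian gridMove (D.empRate N) (D.empCost N) t (v t) m) (Icc 0 D.T) t) →
      ∀ t ∈ Icc 0 D.T, ∀ s ∈ Icc 0 D.T, ∀ m p,
        |v t m - v s p| ≤ C * (|t - s| + ‖m.1 - p.1‖) := by
  obtain ⟨q, hq0, hq⟩ := hA.exists_Q_bound
  obtain ⟨f, hf0, hf⟩ := hA.exists_F_bound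
  obtain ⟨CQ, hCQ⟩ := hA.Q_lipschitz
  obtain ⟨CF, hCF⟩ := hA.F_lipschitz
  obtain ⟨CG, hCG⟩ := hA.G_lipschitz
  set K : ℝ := (|CG| + |CF| * D.T) * Real.exp (2 * d ^ 2 * (q + |CQ|) * D.T) with hK
  -- A bound for the time derivative: each rate is at most `N * q` and each increment at most `K * 2
  -- / N`, so `N` cancels; `f` bounds the running cost.
  set K' : ℝ := d ^ 2 * (q * (K * 2)) + f with hK'
  have hK0 : 0 ≤ K := by positivity
  have hK'0 : 0 ≤ K' := by positivity
  refine ⟨K + K', fun N hN v hvT hv => ?_⟩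
  have hspace : ∀ t ∈ Icc 0 D.T, ∀ m p, v t p - v t m ≤ K * ‖p.1 - m.1‖ := by
    intro t ht m p
    refine (hA.hjb_sub_le hT hN hq0 (abs_nonneg CQ) (abs_nonneg CF) (abs_nonneg CG) hq
      (fun i j t ht a m hm p hp => (hCQ i j t ht t ht a m hm p hp).trans ?_)
      (fun t ht a m hm p hp => (hCF t ht t ht a m hm p hp).trans ?_)
      (fun m hm p hp => (hCG m hm p hp).trans ?_) hvT hv t ht m p).trans ?_
    · simpa using mul_le_mul_of_nonneg_right (le_abs_self CQ) (norm_nonneg (m - p))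
    · simpa using mul_le_mul_of_nonneg_right (le_abs_self CF) (norm_nonneg (m - p))
    · exact mul_le_mul_of_nonneg_right (le_abs_self CG) (norm_nonneg (m - p))
    · have h1 : D.T - t ≤ D.T := by linarith [ht.1]
      have h2 : 0 ≤ D.T - t := by linarith [ht.2]
      rw [hK]
      gcongr
  have habs : ∀ t ∈ Icc 0 D.T, ∀ m p, |v t p - v t m| ≤ K * ‖p.1 - m.1‖ := fun t ht m p => by
    refine abs_le.2 ⟨?_, hspace t ht m p⟩
    have := hspace t ht p m
    rw [norm_sub_rev] at this
    linarith
  have hder : ∀ t ∈ Icc 0 D.T, ∀ m,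
      ‖jumpHamiltonian gridMove (D.empRate N) (D.empCost N) t (v t) m‖ ≤ K' := by
    intro t ht m
    obtain ⟨b, hb⟩ := exists_eq_jumpHamiltonian (τ := gridMove) (hA.continuous_empRate hT (N := N))
      (hA.continuous_empCost hT) t (v t) m
    rw [← hb, Real.norm_eq_abs]
    refine (abs_sub _ _).trans (add_le_add ?_ (hf _ (clampTime_mem hT t) b m.1 m.2.1))
    rw [abs_neg]
    refine (Finset.abs_sum_le_sum_abs _ _).trans
      ((Finset.sum_le_sum (g := fun _ => q * (K * 2)) fun e _ => ?_).trans (le_of_eq ?_))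
    · rw [abs_mul]
      have h1 := (habs t ht m (gridMove m e)).trans
        (mul_le_mul_of_nonneg_left (norm_gridMove_sub_le m e) hK0)
      refine (mul_le_mul (empRate_bound hT hq t b m e) h1 (abs_nonneg _)
        (by positivity)).trans (le_of_eq ?_)
      have : (N : ℝ) ≠ 0 := by positivity
      field_simp
    · simp only [Finset.sum_const, Finset.card_univ, Fintype.card_prod, Fintype.card_fin,
        nsmul_eq_mul, Nat.cast_mul]
      ring
  intro t ht s hs m p
  have h1 : |v t m - v s m| ≤ K' * |t - s| :=
    (convex_Icc 0 D.T).norm_image_sub_le_of_norm_hasDerivWithin_le (f := fun t => v t m)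
      (fun t ht => hv t ht m) (fun t ht => hder t ht m) hs ht
  have h2 := habs s hs p m
  have h3 := abs_add_le (v t m - v s m) (v s m - v s p)
  rw [sub_add_sub_cancel] at h3
  have h4 : 0 ≤ K * |t - s| := by positivity
  have h5 : 0 ≤ K' * ‖m.1 - p.1‖ := by positivity
  linarith

end ControlData

/-! ### Generators acting on functions of the empirical measure -/

namespace ControlData

variable {d N : ℕ} {A : Type*} {D : ControlData d A}

/-- The contribution of an agent in state `i` that uses the action `a` to the running cost plus
the generator applied to `V`. -/
noncomputable def agentDrift (D : ControlData d A) (N : ℕ) (V : StateVec d → ℝ) (t : ℝ)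
    (m : StateVec d) (i : Fin d) (a : A) : ℝ :=
  D.f i t a m + ∑ j, D.Q i j t a m * discreteDeriv N i V m j

/-- The time derivative that the HJB system prescribes. -/
noncomputable def hjbRate (D : ControlData d A) (N : ℕ) (V : StateVec d → ℝ) (t : ℝ)
    (m : StateVec d) : ℝ :=
  ∑ i, m i * D.hamiltonian i t m (discreteDeriv N i V m)

theorem empRunningCost_add_empGenerator (hN : 0 < N) (α : ℝ → Fin d → StateVec d → A) {t : ℝ}
    (ht : t ∈ Icc 0 D.T) (V : StateVec d → ℝ) (m : gridSimplex d N) :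
    D.empRunningCost N α t m + D.empGenerator N α t (fun m => V m.1) m
      = ∑ i, m.1 i * D.agentDrift N V t m.1 i (α t i m.1) := by
  rw [empGenerator_eq_sum_empRate hN α ht, sum_empRate_mul hN, empRunningCost, clampTime_of_mem ht,
    ← Finset.sum_add_distrib]
  exact Finset.sum_congr rfl fun i _ => by rw [agentDrift]; ring

/-- The jumps with `j = x k` do not move the configuration, so including them is harmless. -/
theorem agentGenerator_eq (β : ℝ → (Fin N → Fin d) → Fin N → A) (t : ℝ)
    (φ : (Fin N → Fin d) → ℝ) (x : Fin N → Fin d) :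
    D.agentGenerator β t φ x = ∑ k, ∑ j, D.Q (x k) j t (β t x k) (empirical x) *
      (φ (Function.update x k j) - φ x) := by
  refine Finset.sum_congr rfl fun k _ => ?_
  rw [← Finset.add_sum_erase Finset.univ _ (Finset.mem_univ (x k)), Function.update_eq_self]
  simp

theorem agentRunningCost_add_agentGenerator (hN : 0 < N) (β : ℝ → (Fin N → Fin d) → Fin N → A)
    (t : ℝ) (V : StateVec d → ℝ) (x : Fin N → Fin d) :
    D.agentRunningCost β t x + D.agentGenerator β t (fun x => V (empirical x)) x
      = 1 / (N : ℝ) * ∑ k, D.agentDrift N V t (empirical x) (x k) (β t x k) := by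
  have : (N : ℝ) ≠ 0 := by positivity
  rw [agentGenerator_eq, agentRunningCost]
  simp_rw [agentDrift, Finset.sum_add_distrib, mul_add, empirical_update, discreteDeriv,
    Finset.mul_sum]
  congr 1
  refine Finset.sum_congr rfl fun k _ => Finset.sum_congr rfl fun j _ => ?_
  field_simp

/-- Averaging over agents is weighting by the empirical measure when the action depends only on the
agent's state and that measure. The same optimality condition therefore serves both control
problems. -/
theorem meanField_drift (α : ℝ → Fin d → StateVec d → A) (t : ℝ) (V : StateVec d → ℝ)
    (x : Fin N → Fin d) :
    1 / (N : ℝ) * ∑ k, D.agentDrift N V t (empirical x) (x k) (meanFieldFeedback α t x k)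
      = ∑ i, empirical x i * D.agentDrift N V t (empirical x) i (α t i (empirical x)) :=
  (sum_empirical_mul x fun i => D.agentDrift N V t (empirical x) i (α t i (empirical x))).symm

theorem agentTerminalCost_eq (D : ControlData d A) (x : Fin N → Fin d) :
    D.agentTerminalCost x = D.G (empirical x) :=
  (sum_empirical_mul x fun i => D.g i (empirical x)).symm

theorem IsHJBSolution.empTerminalCost_eq {V : ℝ → StateVec d → ℝ} (hV : D.IsHJBSolution N V) :
    D.empTerminalCost N = fun m : gridSimplex d N => V D.T m.1 :=
  funext fun m => (hV.terminal m.1 m.2).symm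

theorem IsHJBSolution.agentTerminalCost_eq {V : ℝ → StateVec d → ℝ} (hV : D.IsHJBSolution N V) (hN : 0 < N) :
    D.agentTerminalCost = fun x : Fin N → Fin d => V D.T (empirical x) :=
  funext fun x => (ControlData.agentTerminalCost_eq D x).trans
    (hV.terminal _ (empirical_mem hN x)).symm

theorem IsFeedback.meanFieldFeedback [MeasurableSpace A] {α : ℝ → Fin d → StateVec d → A} (hα : IsFeedback N α)
    (hN : 0 < N) : IsAgentFeedback (ControlData.meanFieldFeedback (N := N) α) :=
  fun x k => hα (x k) _ (empirical_mem hN x)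

section Chains

variable [MetricSpace A] [CompactSpace A] [MeasurableSpace A] [BorelSpace A]

theorem AssumptionA.measurable_Q_feedback (hA : D.AssumptionA) (hT : 0 ≤ D.T) (i j : Fin d)
    {m : StateVec d} (hm : m ∈ simplex d) {b : ℝ → A} (hb : Measurable b) :
    Measurable fun t => D.Q i j (clampTime D.T t) (b t) m :=
  (hA.continuous_Q hT i j hm).measurable.comp (measurable_id.prodMk hb)

theorem AssumptionA.intervalIntegrable_F (hA : D.AssumptionA) (hT : 0 ≤ D.T) {m : StateVec d}
    (hm : m ∈ simplex d) {b : ℝ → Fin d → A} (hb : ∀ i, Measurable fun t => b t i) (s t : ℝ) :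
    IntervalIntegrable (fun r => D.F (clampTime D.T r) (b r) m) volume s t := by
  obtain ⟨q, -, hq⟩ := hA.exists_F_bound
  have hmeas : Measurable fun r => D.F (clampTime D.T r) (b r) m :=
    (hA.continuous_F hT hm).measurable.comp (measurable_id.prodMk (measurable_pi_iff.2 hb))
  rw [intervalIntegrable_iff]
  exact Measure.integrableOn_of_bounded (M := q) (by simp) hmeas.aestronglyMeasurable
    (Filter.Eventually.of_forall fun r => hq _ (clampTime_mem hT r) _ _ hm)

theorem AssumptionA.isChainGenerator_emp (hA : D.AssumptionA) (hT : 0 ≤ D.T) (hN : 0 < N)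
    {α : ℝ → Fin d → StateVec d → A} (hα : IsFeedback N α) :
    IsChainGenerator D.T (D.empGenerator N α) := by
  obtain ⟨q, -, hq⟩ := hA.exists_Q_bound
  exact IsChainGenerator.of_jump gridMove
    (r := fun t m => D.empRate N t (fun i => α t i m.1) m) (R := N * q)
    (fun m e => ((hA.measurable_Q_feedback hT e.1 e.2 m.2.1 (hα e.1 m.1 m.2)).const_mul _).const_mul
      _)
    (fun t m e => hA.empRate_nonneg hT t _ m e) (fun t m e => empRate_bound hT hq t _ m e)
    (fun t ht φ m => empGenerator_eq_sum_empRate hN α ht φ m)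

theorem AssumptionA.isChainGenerator_agent (hA : D.AssumptionA) (hT : 0 ≤ D.T) (hN : 0 < N)
    {β : ℝ → (Fin N → Fin d) → Fin N → A} (hβ : IsAgentFeedback β) :
    IsChainGenerator D.T (D.agentGenerator β) := by
  obtain ⟨q, -, hq⟩ := hA.exists_Q_bound
  have hx := fun x : Fin N → Fin d => gridSimplex_subset (empirical_mem hN x)
  exact IsChainGenerator.of_jump (I := Fin N × Fin d) (fun x e => Function.update x e.1 e.2)
    (r := fun t x e => D.Q (x e.1) e.2 (clampTime D.T t) (β t x e.1) (empirical x)) (R := q)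
    (fun x e => hA.measurable_Q_feedback hT _ e.2 (hx x) (hβ x e.1))
    (fun t x e => hA.Q_nonneg _ _ _ (clampTime_mem hT t) _ _ (hx x))
    (fun t x e => hq _ _ _ (clampTime_mem hT t) _ _ (hx x))
    (fun t ht φ x => by
      rw [agentGenerator_eq, Fintype.sum_prod_type]
      simp only [clampTime_of_mem ht])

theorem AssumptionA.intervalIntegrable_empRunningCost (hA : D.AssumptionA)
    {α : ℝ → Fin d → StateVec d → A} (hα : IsFeedback N α) {s : ℝ} (hs : s ∈ Icc 0 D.T)
    (m : gridSimplex d N) :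
    IntervalIntegrable (fun t => D.empRunningCost N α t m) volume s D.T := by
  refine (hA.intervalIntegrable_F (hs.1.trans hs.2) m.2.1 (b := fun t i => α t i m.1)
    (fun i => hα i m.1 m.2) s D.T).congr fun t ht => ?_
  rw [uIoc_of_le hs.2] at ht
  simp only [clampTime_of_mem (show t ∈ Icc 0 D.T from ⟨hs.1.trans ht.1.le, ht.2⟩)]
  rfl

/-- Agents in the same state may act differently, so the running cost is not a value of `F`. Each
agent's term is recovered from `F` by changing one action of a constant reference `a₀` and dividing
by the mass of the agent's state, which is positive. -/
theorem AssumptionA.intervalIntegrable_agentRunningCost [Nonempty A] (hA : D.AssumptionA)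
    (hN : 0 < N) {β : ℝ → (Fin N → Fin d) → Fin N → A} (hβ : IsAgentFeedback β) {s : ℝ}
    (hs : s ∈ Icc 0 D.T) (x : Fin N → Fin d) :
    IntervalIntegrable (fun t => D.agentRunningCost β t x) volume s D.T := by
  obtain ⟨a₀⟩ := ‹Nonempty A›
  have hT := hs.1.trans hs.2
  have hx := gridSimplex_subset (empirical_mem hN x)
  set b₀ : ℝ → Fin d → A := fun _ _ => a₀
  have hb₀ : ∀ i, Measurable fun t => b₀ t i := fun i => measurable_const
  set b : Fin N → ℝ → Fin d → A := fun k t => Function.update (b₀ t) (x k) (β t x k) with hb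
  have hbm : ∀ k i, Measurable fun t => b k t i := fun k i => by
    by_cases h : i = x k
    · subst h
      simpa [hb] using hβ x k
    · simpa [hb, Function.update_of_ne h] using hb₀ i
  have hi0 := hA.intervalIntegrable_F hT hx hb₀ s D.T
  have hi := fun k => hA.intervalIntegrable_F hT hx (hbm k) s D.T
  refine (hi0.add (IntervalIntegrable.sum Finset.univ fun k _ =>
    ((hi k).sub hi0).const_mul (1 / N * (empirical x (x k))⁻¹))).congr fun t ht => ?_
  rw [uIoc_of_le hs.2] at ht
  simp only [Finset.sum_apply,
    clampTime_of_mem (show t ∈ Icc 0 D.T from ⟨hs.1.trans ht.1.le, ht.2⟩), hb, F_update]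
  have h0 : D.F t (b₀ t) (empirical x) = 1 / (N : ℝ) * ∑ k, D.f (x k) t a₀ (empirical x) :=
    sum_empirical_mul x fun i => D.f i t a₀ (empirical x)
  rw [h0, agentRunningCost, Finset.mul_sum, Finset.mul_sum, ← Finset.sum_add_distrib]
  refine Finset.sum_congr rfl fun k _ => ?_
  have := (empirical_apply_self_pos hN x k).ne'
  simp only [b₀]
  field_simp
  ring

end Chains

section Solution

variable [TopologicalSpace A] [CompactSpace A] [Nonempty A] {V : ℝ → StateVec d → ℝ}

theorem AssumptionA.neg_hjbRate_le (hA : D.AssumptionA) {t : ℝ} (ht : t ∈ Icc 0 D.T)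
    {m : StateVec d} (hm : m ∈ simplex d) (W : StateVec d → ℝ) (b : Fin d → A) :
    0 ≤ ∑ i, m i * D.agentDrift N W t m i (b i) + D.hjbRate N W t m := by
  rw [hjbRate, ← Finset.sum_add_distrib]
  refine Finset.sum_nonneg fun i _ => ?_
  have := hA.mul_le_mul_hamiltonian ht hm i (discreteDeriv N i W m) (b i)
  rw [agentDrift]
  linarith

/-- Each agent occupies a state of positive mass, so its own action competes in the Hamiltonian of
that state. Agents sharing a state need not act alike, and this is why centralized control has no
advantage. -/
theorem AssumptionA.neg_hjbRate_le_agents (hA : D.AssumptionA) (hN : 0 < N) {t : ℝ}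
    (ht : t ∈ Icc 0 D.T) (x : Fin N → Fin d) (W : StateVec d → ℝ) (b : Fin N → A) :
    0 ≤ 1 / (N : ℝ) * ∑ k, D.agentDrift N W t (empirical x) (x k) (b k)
      + D.hjbRate N W t (empirical x) := by
  rw [hjbRate, sum_empirical_mul x
    fun i => D.hamiltonian i t (empirical x) (discreteDeriv N i W (empirical x)), ← mul_add,
    ← Finset.sum_add_distrib]
  refine mul_nonneg (by positivity) (Finset.sum_nonneg fun k _ => ?_)
  have := hA.le_hamiltonian ht (gridSimplex_subset (empirical_mem hN x))
    (empirical_apply_self_pos hN x k).ne' (discreteDeriv N (x k) W (empirical x)) (b k)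
  rw [agentDrift]
  linarith

theorem IsHJBSolution.hasDerivWithinAt_jump (hV : D.IsHJBSolution N V) (hA : D.AssumptionA)
    (hN : 0 < N) {t : ℝ} (ht : t ∈ Icc 0 D.T) (m : gridSimplex d N) :
    HasDerivWithinAt (fun s => V s m.1)
      (jumpHamiltonian gridMove (D.empRate N) (D.empCost N) t (fun m => V t m.1) m)
      (Icc 0 D.T) t := by
  rw [hA.jumpHamiltonian_eq hN ht]
  exact hV.ode t ht m.1 m.2

/-- Written as a maximum over `A^d`, the rate is jointly continuous in time and in the values of
`V`, and those are continuous because they are differentiable. -/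
theorem IsHJBSolution.continuousOn_hjbRate (hV : D.IsHJBSolution N V) (hA : D.AssumptionA)
    (hT : 0 ≤ D.T) (hN : 0 < N) {m : StateVec d} (hm : m ∈ gridSimplex d N) :
    ContinuousOn (fun t => D.hjbRate N (V t) t m) (Icc 0 D.T) := by
  have h1 : ContinuousOn (fun t (m : gridSimplex d N) => V t m.1) (Icc 0 D.T) :=
    continuousOn_pi.2 fun m t ht => (hV.ode t ht m.1 m.2).continuousWithinAt
  have h2 := (continuous_jumpHamiltonian (τ := gridMove) (hA.continuous_empRate hT (N := N))
    (hA.continuous_empCost hT) ⟨m, hm⟩).comp_continuousOn (continuousOn_id.prodMk h1)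
  exact h2.congr fun t ht => (hA.jumpHamiltonian_eq hN ht ⟨m, hm⟩ (V t)).symm

theorem IsHJBSolution.contDiffOn (hV : D.IsHJBSolution N V) (hA : D.AssumptionA)
    (hT : 0 < D.T) (hN : 0 < N) {m : StateVec d} (hm : m ∈ gridSimplex d N) :
    ContDiffOn ℝ 1 (fun t => V t m) (Icc 0 D.T) := by
  have hu := uniqueDiffOn_Icc hT
  rw [contDiffOn_one_iff_derivWithin hu]
  exact ⟨fun t ht => (hV.ode t ht m hm).differentiableWithinAt,
    (hV.continuousOn_hjbRate hA hT.le hN hm).congr fun t ht =>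
      (hV.ode t ht m hm).derivWithin (hu t ht)⟩

theorem IsHJBSolution.le (hA : D.AssumptionA) (hT : 0 ≤ D.T) (hN : 0 < N)
    {W : ℝ → StateVec d → ℝ} (hV : D.IsHJBSolution N V) (hW : D.IsHJBSolution N W) {t : ℝ}
    (ht : t ∈ Icc 0 D.T) {m : StateVec d} (hm : m ∈ gridSimplex d N) : V t m ≤ W t m :=
  hjb_solution_le (τ := gridMove) (v := fun t (m : gridSimplex d N) => V t m.1)
    (w := fun t m => W t m.1) (hA.continuous_empRate hT (N := N)) (hA.continuous_empCost hT)
    (hA.empRate_nonneg hT) (fun m => by rw [hV.terminal m.1 m.2, hW.terminal m.1 m.2])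
    (fun _ ht m => hV.hasDerivWithinAt_jump hA hN ht m)
    (fun _ ht m => hW.hasDerivWithinAt_jump hA hN ht m) t ht ⟨m, hm⟩

theorem AssumptionA.exists_isHJBSolution (hA : D.AssumptionA) (hT : 0 ≤ D.T) (hN : 0 < N) :
    ∃ V, D.IsHJBSolution N V := by
  classical
  obtain ⟨q, hq0, hq⟩ := hA.exists_Q_bound
  obtain ⟨v, -, hvT, hv⟩ := exists_hjb_solution (τ := gridMove) hT
    (hA.continuous_empRate hT (N := N)) (hA.continuous_empCost hT) (R := N * q) (by positivity)
    (empRate_bound hT hq) (fun m => D.G m.1)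
  set V : ℝ → StateVec d → ℝ := fun t m => if h : m ∈ gridSimplex d N then v t ⟨m, h⟩ else 0
  have hVv : ∀ t, (fun m : gridSimplex d N => V t m.1) = v t := fun t => by
    ext m
    simp [V]
  refine ⟨V, fun t ht m hm => ?_, fun m hm => ?_⟩
  · have h := (hv t ht ⟨m, hm⟩).hasDerivWithinAt (s := Icc 0 D.T)
    rw [← hVv t, hA.jumpHamiltonian_eq hN ht] at h
    simpa only [V, dif_pos hm] using h
  · simp only [V, dif_pos hm, hvT]
    rfl

end Solution

/-! ### Optimal feedback and verification of the values -/

section Values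

variable [MetricSpace A] [CompactSpace A] [Nonempty A] [MeasurableSpace A] [BorelSpace A]
  {V : ℝ → StateVec d → ℝ}

/-- There is a measurable feedback that attains the Hamiltonians along a solution. -/
theorem IsHJBSolution.exists_optimal (hV : D.IsHJBSolution N V) (hA : D.AssumptionA)
    (hT : 0 ≤ D.T) (hN : 0 < N) : ∃ α : ℝ → Fin d → StateVec d → A, IsFeedback N α ∧
      ∀ t ∈ Icc 0 D.T, ∀ m ∈ gridSimplex d N,
        ∑ i, m i * D.agentDrift N (V t) t m i (α t i m) + D.hjbRate N (V t) t m = 0 := by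
  classical
  have hVc : Continuous fun t (m : gridSimplex d N) => V (clampTime D.T t) m.1 := by
    refine continuous_pi fun m => ?_
    have h : ContinuousOn (fun t => V t m.1) (Icc 0 D.T) := fun t ht =>
      (hV.ode t ht m.1 m.2).continuousWithinAt
    exact h.comp_continuous (continuous_clampTime _) (clampTime_mem hT)
  have hsel : ∀ m : gridSimplex d N, ∃ b : ℝ → Fin d → A, Measurable b ∧ ∀ t ∈ Icc 0 D.T,
      ∑ i, m.1 i * D.agentDrift N (V t) t m.1 i (b t i) + D.hjbRate N (V t) t m.1 = 0 := by
    intro m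
    obtain ⟨b, hb, hmax⟩ := exists_measurable_argmax (Ω := ℝ) (B := Fin d → A)
      (ψ := fun t b => -(∑ e, D.empRate N t b m e *
        (V (clampTime D.T t) (gridMove m e).1 - V (clampTime D.T t) m.1)) - D.empCost N t b m)
      ((continuous_jump_integrand (τ := gridMove) (hA.continuous_empRate hT (N := N))
        (hA.continuous_empCost hT) m).comp
        (f := fun z : ℝ × (Fin d → A) =>
          ((z.1, fun m : gridSimplex d N => V (clampTime D.T z.1) m.1), z.2))
        ((continuous_fst.prodMk (hVc.comp continuous_fst)).prodMk continuous_snd))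
    refine ⟨b, hb, fun t ht => ?_⟩
    have h1 : jumpHamiltonian gridMove (D.empRate N) (D.empCost N) t (fun m => V t m.1) m
        ≤ -(∑ e, D.empRate N t (b t) m e * (V t (gridMove m e).1 - V t m.1))
          - D.empCost N t (b t) m :=
      ciSup_le fun b' => by
        have := hmax t b'
        simpa only [clampTime_of_mem ht] using this
    rw [hA.jumpHamiltonian_eq hN ht, empIntegrand_eq hN ht] at h1
    -- One inequality holds for every action; the other is the maximality of the selected joint
    -- action.
    refine le_antisymm ?_ (hA.neg_hjbRate_le ht m.2.1 (V t) (b t))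
    rw [hjbRate]
    have h2 : ∑ i, m.1 i * D.agentDrift N (V t) t m.1 i (b t i)
        = -∑ i, m.1 i * (-(∑ j, D.Q i j t (b t i) m.1 * discreteDeriv N i (V t) m.1 j)
          - D.f i t (b t i) m.1) := by
      rw [← Finset.sum_neg_distrib]
      exact Finset.sum_congr rfl fun i _ => by rw [agentDrift]; ring
    linarith
  choose b hb hopt using hsel
  refine ⟨fun t i m => if h : m ∈ gridSimplex d N then b ⟨m, h⟩ t i else Classical.arbitrary A,
    fun i m hm => ?_, fun t ht m hm => ?_⟩
  · simp only [dif_pos hm]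
    exact (measurable_pi_apply i).comp (hb ⟨m, hm⟩)
  · simp only [dif_pos hm]
    exact hopt ⟨m, hm⟩ t ht

/-- Along any feedback, running cost plus generator plus time derivative of `V` is nonnegative by
the HJB equation, so `V` is a subsolution in the verification argument. -/
theorem IsHJBSolution.le_empCost (hV : D.IsHJBSolution N V) (hA : D.AssumptionA) (hN : 0 < N)
    {s : ℝ} (hs : s ∈ Icc 0 D.T) {ν : gridSimplex d N → ℝ} (hν : ∀ m, 0 ≤ ν m) {J : ℝ}
    (hJ : J ∈ D.empCosts N s ν) : ∑ m, ν m * V s m.1 ≤ J := by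
  obtain ⟨α, hα, p, hp, rfl⟩ := hJ
  have hT := hs.1.trans hs.2
  rw [hV.empTerminalCost_eq]
  refine (hA.isChainGenerator_emp hT hN hα).le_expectedCost hp hs.1 hs.2 hν
    (v := fun t m => V t m.1) (v' := fun t m => D.hjbRate N (V t) t m.1)
    (hA.intervalIntegrable_empRunningCost hα hs) (fun t ht m => hV.ode t ht m.1 m.2)
    (fun m => hV.continuousOn_hjbRate hA hT hN m.2) fun t ht m => ?_
  rw [empRunningCost_add_empGenerator hN α ht]
  exact hA.neg_hjbRate_le ht m.2.1 (V t) _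

theorem IsHJBSolution.isEmpCost (hV : D.IsHJBSolution N V) (hA : D.AssumptionA) (hN : 0 < N)
    {α : ℝ → Fin d → StateVec d → A} (hα : IsFeedback N α)
    (hopt : ∀ t ∈ Icc 0 D.T, ∀ m ∈ gridSimplex d N,
      ∑ i, m i * D.agentDrift N (V t) t m i (α t i m) + D.hjbRate N (V t) t m = 0)
    {s : ℝ} (hs : s ∈ Icc 0 D.T) (ν : gridSimplex d N → ℝ) :
    D.IsEmpCost N α s ν (∑ m, ν m * V s m.1) := by
  have hT := hs.1.trans hs.2
  have hL := hA.isChainGenerator_emp hT hN hα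
  obtain ⟨p, hp⟩ := hL.exists_transition
  refine ⟨p, hp, ?_⟩
  rw [hV.empTerminalCost_eq]
  refine (hL.expectedCost_eq_of_solution hp hs.1 hs.2 ν
    (v := fun t m => V t m.1) (v' := fun t m => D.hjbRate N (V t) t m.1)
    (hA.intervalIntegrable_empRunningCost hα hs) (fun t ht m => hV.ode t ht m.1 m.2)
    (fun m => hV.continuousOn_hjbRate hA hT hN m.2) fun t ht m => ?_).symm
  rw [empRunningCost_add_empGenerator hN α ht]
  exact hopt t ht m.1 m.2

theorem IsHJBSolution.le_agentCost (hV : D.IsHJBSolution N V) (hA : D.AssumptionA) (hN : 0 < N)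
    {s : ℝ} (hs : s ∈ Icc 0 D.T) {ν : (Fin N → Fin d) → ℝ} (hν : ∀ x, 0 ≤ ν x) {J : ℝ}
    (hJ : J ∈ D.agentCosts N s ν) : ∑ x, ν x * V s (empirical x) ≤ J := by
  obtain ⟨β, hβ, p, hp, rfl⟩ := hJ
  have hT := hs.1.trans hs.2
  rw [hV.agentTerminalCost_eq hN]
  refine (hA.isChainGenerator_agent hT hN hβ).le_expectedCost hp hs.1 hs.2 hν
    (v := fun t x => V t (empirical x)) (v' := fun t x => D.hjbRate N (V t) t (empirical x))
    (hA.intervalIntegrable_agentRunningCost hN hβ hs)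
    (fun t ht x => hV.ode t ht _ (empirical_mem hN x))
    (fun x => hV.continuousOn_hjbRate hA hT hN (empirical_mem hN x)) fun t ht x => ?_
  rw [agentRunningCost_add_agentGenerator hN]
  exact hA.neg_hjbRate_le_agents hN ht x (V t) _

theorem IsHJBSolution.isAgentCost (hV : D.IsHJBSolution N V) (hA : D.AssumptionA) (hN : 0 < N)
    {α : ℝ → Fin d → StateVec d → A} (hα : IsFeedback N α)
    (hopt : ∀ t ∈ Icc 0 D.T, ∀ m ∈ gridSimplex d N,
      ∑ i, m i * D.agentDrift N (V t) t m i (α t i m) + D.hjbRate N (V t) t m = 0)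
    {s : ℝ} (hs : s ∈ Icc 0 D.T) (ν : (Fin N → Fin d) → ℝ) :
    D.IsAgentCost (ControlData.meanFieldFeedback α) s ν (∑ x, ν x * V s (empirical x)) := by
  have hT := hs.1.trans hs.2
  have hβ := hα.meanFieldFeedback hN
  have hL := hA.isChainGenerator_agent hT hN hβ
  obtain ⟨p, hp⟩ := hL.exists_transition
  refine ⟨p, hp, ?_⟩
  rw [hV.agentTerminalCost_eq hN]
  refine (hL.expectedCost_eq_of_solution hp hs.1 hs.2 ν
    (v := fun t x => V t (empirical x)) (v' := fun t x => D.hjbRate N (V t) t (empirical x))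
    (hA.intervalIntegrable_agentRunningCost hN hβ hs)
    (fun t ht x => hV.ode t ht _ (empirical_mem hN x))
    (fun x => hV.continuousOn_hjbRate hA hT hN (empirical_mem hN x)) fun t ht x => ?_).symm
  rw [agentRunningCost_add_agentGenerator hN, meanField_drift]
  exact hopt t ht _ (empirical_mem hN x)

end Values

end ControlData

/-! ### Proof of the proposition -/

theorem diracLaw_nonneg {S : Type*} (x y : S) : 0 ≤ diracLaw x y := by
  unfold diracLaw
  split_ifs <;> simp

theorem empiricalLaw_nonneg {d N : ℕ} {ν : (Fin N → Fin d) → ℝ} (hν : ∀ x, 0 ≤ ν x)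
    (m : gridSimplex d N) : 0 ≤ empiricalLaw ν m :=
  Finset.sum_nonneg fun x _ => by
    split_ifs
    · exact hν x
    · exact le_rfl

theorem proposition2p3 {d : ℕ} {A : Type*} [MetricSpace A] [CompactSpace A] [Nonempty A]
    [MeasurableSpace A] [BorelSpace A] (D : ControlData d A) (hT : 0 < D.T)
    (hA : D.AssumptionA) :
    ∃ C : ℝ, ∀ N : ℕ, 0 < N → ∃ V : ℝ → StateVec d → ℝ,
      -- the HJB system has a solution, it is `C¹` in time, and it is unique
      D.IsHJBSolution N V ∧
      (∀ m ∈ gridSimplex d N, ContDiffOn ℝ 1 (fun t => V t m) (Icc 0 D.T)) ∧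
      (∀ W : ℝ → StateVec d → ℝ, D.IsHJBSolution N W →
        ∀ t ∈ Icc 0 D.T, ∀ m ∈ gridSimplex d N, W t m = V t m) ∧
      -- the controlled Markov chains are well defined for all feedback controls
      (∀ α : ℝ → Fin d → StateVec d → A, ControlData.IsFeedback N α →
        (∃ p, IsTransitionFunction D.T (D.empGenerator N α) p) ∧
        ∀ p p', IsTransitionFunction D.T (D.empGenerator N α) p →
          IsTransitionFunction D.T (D.empGenerator N α) p' →
          ∀ s t, 0 ≤ s → s ≤ t → t ≤ D.T → p s t = p' s t) ∧
      (∀ β : ℝ → (Fin N → Fin d) → Fin N → A, ControlData.IsAgentFeedback β →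
        (∃ p, IsTransitionFunction D.T (D.agentGenerator β) p) ∧
        ∀ p p', IsTransitionFunction D.T (D.agentGenerator β) p →
          IsTransitionFunction D.T (D.agentGenerator β) p' →
          ∀ s t, 0 ≤ s → s ≤ t → t ≤ D.T → p s t = p' s t) ∧
      -- `V` is the value function of the control problem for the empirical measure
      (∀ t ∈ Icc 0 D.T, ∀ m : gridSimplex d N, IsGLB (D.empCosts N t (diracLaw m)) (V t m.1)) ∧
      -- there is an optimal feedback
      (∃ α : ℝ → Fin d → StateVec d → A, ControlData.IsFeedback N α ∧
        ∀ t ∈ Icc 0 D.T, ∀ m : gridSimplex d N, D.IsEmpCost N α t (diracLaw m) (V t m.1)) ∧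
      -- Lipschitz continuity, with a constant that does not depend on `N`
      (∀ t ∈ Icc 0 D.T, ∀ s ∈ Icc 0 D.T, ∀ m ∈ gridSimplex d N, ∀ p ∈ gridSimplex d N,
        |V t m - V s p| ≤ C * (|t - s| + ‖m - p‖)) ∧
      -- the value function of the `N`-agent problem at `(t, x)` is `V t (empirical x)`
      (∀ t ∈ Icc 0 D.T, ∀ x : Fin N → Fin d,
        IsGLB (D.agentCosts N t (diracLaw x)) (V t (empirical x))) ∧
      -- for i.i.d. initial states the problems have the same (finite) infimum
      (∀ m₀ ∈ simplex d, ∃ c : ℝ,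
        IsGLB (D.agentCosts N 0 (iidLaw N m₀)) c ∧
        IsGLB (D.meanFieldAgentCosts N 0 (iidLaw N m₀)) c ∧
        IsGLB (D.empCosts N 0 (empiricalLaw (iidLaw N m₀))) c) := by
  obtain ⟨C, hC⟩ := hA.exists_hjb_lipschitz hT.le
  refine ⟨C, fun N hN => ?_⟩
  obtain ⟨V, hV⟩ := hA.exists_isHJBSolution hT.le hN
  obtain ⟨α, hα, hopt⟩ := hV.exists_optimal hA hT.le hN
  -- The common value for i.i.d. initial states is the mean of `V 0` at the initial empirical
  -- measure.
  refine ⟨V, hV, fun m hm => hV.contDiffOn hA hT hN hm, fun W hW t ht m hm =>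
    le_antisymm (hW.le hA hT.le hN hV ht hm) (hV.le hA hT.le hN hW ht hm), fun α' hα' => ?_,
    fun β hβ => ?_, fun t ht m => ?_, ⟨α, hα, fun t ht m => ?_⟩, fun t ht s hs m hm p hp => ?_,
    fun t ht x => ?_, fun m₀ hm₀ => ⟨∑ x, iidLaw N m₀ x * V 0 (empirical x), ?_, ?_, ?_⟩⟩
  · have h := hA.isChainGenerator_emp hT.le hN hα'
    exact ⟨h.exists_transition, fun p p' hp hp' s t hs hst ht =>
      h.transition_unique hp hp' hs hst ht⟩
  · have h := hA.isChainGenerator_agent hT.le hN hβ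
    exact ⟨h.exists_transition, fun p p' hp hp' s t hs hst ht =>
      h.transition_unique hp hp' hs hst ht⟩
  · rw [← sum_diracLaw_mul m fun m => V t m.1]
    exact IsLeast.isGLB ⟨⟨α, hα, hV.isEmpCost hA hN hα hopt ht _⟩,
      fun J hJ => hV.le_empCost hA hN ht (diracLaw_nonneg m) hJ⟩
  · rw [← sum_diracLaw_mul m fun m => V t m.1]
    exact hV.isEmpCost hA hN hα hopt ht _
  · exact hC N hN (fun t m => V t m.1) (fun m => hV.terminal m.1 m.2)
      (fun t ht m => hV.hasDerivWithinAt_jump hA hN ht m) t ht s hs ⟨m, hm⟩ ⟨p, hp⟩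
  · rw [← sum_diracLaw_mul x fun x => V t (empirical x)]
    exact IsLeast.isGLB ⟨⟨_, hα.meanFieldFeedback hN, hV.isAgentCost hA hN hα hopt ht _⟩,
      fun J hJ => hV.le_agentCost hA hN ht (diracLaw_nonneg x) hJ⟩
  · exact IsLeast.isGLB ⟨⟨_, hα.meanFieldFeedback hN,
      hV.isAgentCost hA hN hα hopt ⟨le_rfl, hT.le⟩ _⟩,
      fun J hJ => hV.le_agentCost hA hN ⟨le_rfl, hT.le⟩ (iidLaw_nonneg hm₀) hJ⟩
  · exact IsLeast.isGLB ⟨⟨α, hα, hV.isAgentCost hA hN hα hopt ⟨le_rfl, hT.le⟩ _⟩,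
      fun J ⟨α', hα', hJ⟩ => hV.le_agentCost hA hN ⟨le_rfl, hT.le⟩ (iidLaw_nonneg hm₀)
        ⟨_, hα'.meanFieldFeedback hN, hJ⟩⟩
  · rw [← sum_empiricalLaw_mul hN (iidLaw N m₀) (V 0)]
    exact IsLeast.isGLB ⟨⟨α, hα, hV.isEmpCost hA hN hα hopt ⟨le_rfl, hT.le⟩ _⟩,
      fun J hJ => hV.le_empCost hA hN ⟨le_rfl, hT.le⟩
        (empiricalLaw_nonneg (iidLaw_nonneg hm₀)) hJ⟩
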